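/- For real $a,b$ and $n\in\mathbb N=\{0,1,2,\dots\}$ let $$P_n^{(a,b)}(x)=\sum_{s=0}^{n}\binom{n+a}{n-s}\binom{n+b}{s}\Big(\frac{x-1}{2}\Big)^{s}\Big(\frac{x+1}{2}\Big)^{n-s}$$ be the Jacobi polynomial, where $\binom{t}{k}=t(t-1)\cdots(t-k+1)/k!$. For $m\in\mathbb N$ put $\xi_{a,b,m}=P_m^{(-a,b)}$, and let $A_{a,b,m}$ be the operator $$A_{a,b,m}(y)=(1-x)\,\xi_{a,b,m}\,y'+(m-a)\,\xi_{a+1,b+1,m}\,y$$ from the rational factorization of the Jacobi operator. The $X_m$ Jacobi polynomials are $$\hat P^{(\alpha,\beta,m)}_n=\frac{(-1)^{m+1}}{\alpha+1+j}\,A_{\alpha+1,\beta-1,m}\big(P^{(\alpha+1,\beta-1)}_j\big),\qquad j=n-m\ge 0 .$$ A polynomial flag is a sequence $U_1\subset U_2\subset\cdots$ of subspaces of $\mathbb R[x]$ with $\dim U_k=k$; let $n_k$ be the largest degree of an element of $U_k$. The flag is degree-regular if $n_k<n_{k+1}$ for all $k$, and it has stable codimension $m$ if $n_k+1-k=m$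 for all $k$. Theorem. Let $m>1$ be an integer and let $\alpha,\beta>-1$ be real numbers with $\alpha>m-2$, $\operatorname{sgn}(\alpha-m+1)=\operatorname{sgn}(\beta)$, and $\alpha,\ \alpha-\beta-m+1\notin\{0,1,\dots,m-1\}$. Let $\mathcal U$ be the space of all real polynomials $y$ such that $(1+x)y'+\beta y$ is divisible by $P_m^{(-\alpha-1,\beta-1)}$, and let $$\hat W_{\alpha,\beta,m}(x)=\frac{(1-x)^\alpha(1+x)^\beta}{\xi_{\alpha+1,\beta-1,m}(x)^2},\qquad x\in(-1,1).$$ Then: (1) There is exactly one degree-regular flag $\{U_k\}_{k\ge1}$ with $\bigcup_k U_k=\mathcal U$, and it has stable codimension $m$. (2) $\hat W_{\alpha,\beta,m}$ is positive on $(-1,1)$ and has finite moments of all orders, and the polynomials $\hat P^{(\alpha,\beta,m)}_n$, $n\ge m$, form an orthogonal polynomial system for it, that is, an orthogonal basis of the Hilbert space $L^2\big((-1,1),\hat W_{\alpha,\beta,m}\,dx\big)$. (3) The sequence $\big(\hat P^{(\alpha,\beta,m)}_n\big)_{n\ge m}$ is obtained by orthogonalizing the flag $\{U_k\}$ with respect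 to $\hat W_{\alpha,\beta,m}\,dx$ and imposing the normalization below: it is the one and only sequence of polynomials $(y_n)_{n\ge m}$ such that $U_k=\operatorname{span}\{y_m,\dots,y_{m+k-1}\}$ for all $k\ge1$, $\int_{-1}^1 y_i\,y_n\,\hat W_{\alpha,\beta,m}\,dx=0$ for $i\ne n$, and $$y_n(1)=\binom{\alpha+n-m}{n}\binom{n}{m},\qquad n\ge m .$$ -/

import Mathlib

open Polynomial MeasureTheory
open scoped ENNReal

/-! ### Polynomial flags -/

/-- A flag `U 0 ⊂ U 1 ⊂ …` of spaces of real polynomials. The index is shifted by one with respect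
to the convention `dim U_k = k`, `k ≥ 1`, so that here `dim (U k) = k + 1`. -/
structure PolynomialFlag where
  space : ℕ → Submodule ℝ ℝ[X]
  mono : Monotone space
  finrank_space : ∀ k, Module.finrank ℝ (space k) = k + 1

namespace PolynomialFlag

/-- The degree of the `k`-th space: the maximum of the degrees of its elements.
The set is bounded, as the space is finite-dimensional. -/
noncomputable def degree (F : PolynomialFlag) (k : ℕ) : ℕ :=
  sSup (Polynomial.natDegree '' (F.space k : Set ℝ[X]))

/-- The codimension of the `k`-th space in the space of all polynomials of degree at most
`F.degree k`. -/
noncomputable def codim (F : PolynomialFlag) (k : ℕ) : ℤ :=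
  ((F.degree k : ℤ) + 1) - (Module.finrank ℝ (F.space k) : ℤ)

/-- The degrees of the spaces of the flag increase strictly. -/
def IsDegreeRegular (F : PolynomialFlag) : Prop := StrictMono F.degree

/-- All the codimensions are equal to `m`. -/
def HasStableCodim (F : PolynomialFlag) (m : ℕ) : Prop := ∀ k, F.codim k = m

/-- The flag is degree regular and its spaces exhaust the subspace `U`. -/
def Exhausts (F : PolynomialFlag) (U : Submodule ℝ ℝ[X]) : Prop :=
  F.IsDegreeRegular ∧ ⨆ k, F.space k = U

/-- The sequence `y` arises from the flag by orthogonalization in `L²(μ)`: the first `k + 1`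
members span the `k`-th space, and distinct members are orthogonal. -/
def IsOrthogonalization (F : PolynomialFlag) (μ : Measure ℝ) (y : ℕ → ℝ[X]) : Prop :=
  (∀ k, F.space k = Submodule.span ℝ (y '' Set.Iic k)) ∧
    ∀ i j, i ≠ j → ∫ x, (y i).eval x * (y j).eval x ∂μ = 0

end PolynomialFlag

/-! ### Orthogonal polynomial systems -/

/-- The measure `W(x) dx` on the open interval `(a, b)`. -/
noncomputable def weightMeasure (a b : ℝ) (W : ℝ → ℝ) : Measure ℝ :=
  (volume.restrict (Set.Ioo a b)).withDensity fun x => ENNReal.ofReal (W x)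

/-- `W` is a positive weight on `(a, b)` with finite moments of all orders, and the polynomials
`y 0, y 1, …` form an orthogonal basis of the Hilbert space `L²((a, b), W dx)`. -/
structure IsOrthogonalPolynomialSystem (a b : ℝ) (W : ℝ → ℝ) (y : ℕ → ℝ[X]) : Prop where
  weight_pos : ∀ x ∈ Set.Ioo a b, 0 < W x
  finite_moments : ∀ n : ℕ, Integrable (fun x => x ^ n) (weightMeasure a b W)
  ne_zero : ∀ k, y k ≠ 0
  orthogonal : ∀ i j, i ≠ j → ∫ x, (y i).eval x * (y j).eval x ∂(weightMeasure a b W) = 0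
  dense : ∀ f : ℝ → ℝ, MemLp f 2 (weightMeasure a b W) → ∀ ε : ℝ≥0∞, 0 < ε →
    ∃ q ∈ Submodule.span ℝ (Set.range y),
      eLpNorm (fun x => f x - q.eval x) 2 (weightMeasure a b W) < ε

/-! ### Jacobi and exceptional Jacobi polynomials -/

/-- The Jacobi polynomial `P_n^{(a,b)}` for arbitrary real parameters `a`, `b`:
`∑ s, C(n + a, n - s) C(n + b, s) ((x - 1) / 2)^s ((x + 1) / 2)^(n - s)`, where `C` is the
generalized binomial coefficient. -/
noncomputable def jacobiPoly (a b : ℝ) (n : ℕ) : ℝ[X] :=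
  ∑ s ∈ Finset.range (n + 1),
    C (Ring.choose ((n : ℝ) + a) (n - s) * Ring.choose ((n : ℝ) + b) s) *
      (C (1 / 2) * (X - 1)) ^ s * (C (1 / 2) * (X + 1)) ^ (n - s)

/-- `ξ_{a,b,m} = P_m^{(-a,b)}`. -/
noncomputable def xiPoly (a b : ℝ) (m : ℕ) : ℝ[X] := jacobiPoly (-a) b m

/-- The first-order operator
`A_{a,b,m} y = (1 - x) ξ_{a,b,m} y' + (m - a) ξ_{a+1,b+1,m} y`, the right factor in the rational
factorization of the Jacobi operator. -/
noncomputable def jacobiA (a b : ℝ) (m : ℕ) (y : ℝ[X]) : ℝ[X] :=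
  (1 - X) * xiPoly a b m * derivative y + C ((m : ℝ) - a) * xiPoly (a + 1) (b + 1) m * y

/-- The exceptional `X_m` Jacobi polynomial of degree `n`, for `n ≥ m`:
`(-1)^(m+1) / (α + 1 + j) • A_{α+1,β-1,m} P_j^{(α+1,β-1)}` with `j = n - m`. -/
noncomputable def xmJacobi (α β : ℝ) (m n : ℕ) : ℝ[X] :=
  C ((-1) ^ (m + 1) / (α + 1 + ((n - m : ℕ) : ℝ))) *
    jacobiA (α + 1) (β - 1) m (jacobiPoly (α + 1) (β - 1) (n - m))

/-- The weight `(1 - x)^α (1 + x)^β / ξ_{α+1,β-1,m}(x)²`. -/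
noncomputable def xmWeight (α β : ℝ) (m : ℕ) (x : ℝ) : ℝ :=
  (1 - x) ^ α * (1 + x) ^ β / (xiPoly (α + 1) (β - 1) m).eval x ^ 2

/-- The space of all polynomials `y` such that `(1 + x) y' + β y` is divisible by
`P_m^{(-α-1,β-1)}`. -/
noncomputable def xmSubspace (α β : ℝ) (m : ℕ) : Submodule ℝ ℝ[X] where
  carrier := {y | jacobiPoly (-α - 1) (β - 1) m ∣ (1 + X) * derivative y + C β * y}
  zero_mem' := by simp
  add_mem' := by
    intro y z hy hz
    change _ ∣ (1 + X) * derivative (y + z) + C β * (y + z)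
    have h := dvd_add hy hz
    rw [derivative_add]
    convert h using 1
    ring
  smul_mem' := by
    intro c y hy
    change _ ∣ (1 + X) * derivative (c • y) + C β * (c • y)
    have h := Dvd.dvd.mul_left hy (C c)
    rw [derivative_smul, smul_eq_C_mul, smul_eq_C_mul]
    convert h using 1
    ring

/-! ### Generalized binomial coefficients -/

/-! Write ξ for `xiPoly (α + 1) (β - 1) m` and y_k for the exceptional polynomial of degree m + k.
Two shift relations between Jacobi polynomials factor the Jacobi operator, up to a constant, as B ∘
A, with A = `jacobiA` and B y = ((1 + x) y' + β y) / ξ. Since y_k is a multiple of A P_k, B y_k is a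
multiple of P_k (`left_factor_xmJacobi`), so y_k lies in 𝒰; composing in the other order, A ∘ B,
gives a second-order equation for y_k (`xmJacobi_ode`).

Flag: the excluded parameter values make deg ξ = m and deg y_k = m + k. For y ≠ 0 of degree d, the
coefficient of degree d in (1 + x) y' + β y is d + β ≠ 0 times the leading coefficient of y, so
divisibility by ξ forces d ≥ m. Hence the y_k form a basis of 𝒰 with degrees m, m + 1, …, and a
dimension count leaves only one degree-regular flag (`IsDegreeBasis.exhausts_iff`).

Orthogonality: the sign condition gives all terms of the sum defining ξ the same sign on [-1, 1], so
ξ has no zero there (`xiPoly_eval_ne_zero`). In Sturm–Liouville form the equation makes W y_i y_j,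
up to a nonzero constant, the derivative of a weighted Wronskian that vanishes at ±1.

Density: 𝒰 contains ξ² ℝ[x], and ξ² is bounded above and away from 0, so density of all polynomials
carries over.

Uniqueness: orthogonalization fixes each member up to a factor, and the value at 1, which is
nonzero, fixes that factor. -/

theorem choose_eq_prod_div (t : ℝ) (k : ℕ) :
    Ring.choose t k = (∏ i ∈ Finset.range k, (t - i)) / (k.factorial : ℝ) := by
  have h := Ring.descPochhammer_eq_factorial_smul_choose t k
  rw [Polynomial.descPochhammer_smeval_eq_ascPochhammer,
    Polynomial.ascPochhammer_smeval_eq_eval] at h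
  rw [← descPochhammer_eval_eq_prod_range, descPochhammer_eval_eq_ascPochhammer, h, nsmul_eq_mul]
  field_simp

theorem choose_succ_mul (t : ℝ) (k : ℕ) :
    ((k : ℝ) + 1) * Ring.choose t (k + 1) = (t - k) * Ring.choose t k := by
  rw [choose_eq_prod_div, choose_eq_prod_div, Finset.prod_range_succ, Nat.factorial_succ]
  push_cast
  field_simp

theorem sub_mul_choose (t : ℝ) (k : ℕ) :
    (t - k) * Ring.choose t k = t * Ring.choose (t - 1) k := by
  rw [choose_eq_prod_div, choose_eq_prod_div]
  have h := Finset.prod_range_succ (fun i : ℕ => t - (i : ℝ)) k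
  rw [Finset.prod_range_succ'] at h
  have h2 : ∏ i ∈ Finset.range k, (t - ((i + 1 : ℕ) : ℝ)) =
      ∏ i ∈ Finset.range k, (t - 1 - (i : ℝ)) := by
    refine Finset.prod_congr rfl fun i _ => ?_
    push_cast; ring
  rw [h2] at h
  simp only [Nat.cast_zero, sub_zero] at h
  rw [mul_div_assoc', mul_div_assoc', mul_comm t, h, mul_comm]

theorem choose_add_one_succ (t : ℝ) (k : ℕ) :
    Ring.choose (t + 1) (k + 1) = Ring.choose t k + Ring.choose t (k + 1) :=
  Ring.choose_succ_succ t k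

theorem choose_ne_zero {t : ℝ} {k : ℕ} (h : ∀ i < k, t ≠ (i : ℝ)) : Ring.choose t k ≠ 0 := by
  rw [choose_eq_prod_div]
  refine div_ne_zero (Finset.prod_ne_zero_iff.2 fun i hi => ?_) (by positivity)
  exact sub_ne_zero.2 (h i (Finset.mem_range.1 hi))

theorem choose_pos_of_lt {t : ℝ} {k : ℕ} (h : (k : ℝ) - 1 < t) : 0 < Ring.choose t k := by
  rw [choose_eq_prod_div]
  refine div_pos (Finset.prod_pos fun i hi => ?_) (by positivity)
  have : ((i : ℝ) + 1) ≤ k := by exact_mod_cast Finset.mem_range.1 hi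
  linarith

theorem neg_one_pow_mul_choose_pos {t : ℝ} (ht : t < 0) (k : ℕ) :
    0 < (-1) ^ k * Ring.choose t k := by
  induction k with
  | zero => simp
  | succ k ih =>
    have h := choose_succ_mul t k
    have hk : (0 : ℝ) < (k : ℝ) + 1 := by positivity
    have : (-1) ^ (k + 1) * Ring.choose t (k + 1) =
        ((k - t) / (k + 1)) * ((-1) ^ k * Ring.choose t k) := by
      rw [div_mul_eq_mul_div, eq_div_iff hk.ne']
      linear_combination (-1) ^ (k + 1) * h
    rw [this]
    have : (0 : ℝ) < k - t := by
      have : (0 : ℝ) ≤ k := k.cast_nonneg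
      linarith
    positivity

/-- The sign of `C(t, k)`, `k ≥ 1`, for `t` in the unit interval. -/
theorem neg_one_pow_mul_choose_succ_pos {t : ℝ} (h0 : 0 < t) (h1 : t < 1) (k : ℕ) :
    0 < (-1) ^ k * Ring.choose t (k + 1) := by
  have h := choose_succ_mul t k
  rw [sub_mul_choose] at h
  have hk : (0 : ℝ) < (k : ℝ) + 1 := by positivity
  have h2 := neg_one_pow_mul_choose_pos (t := t - 1) (by linarith) k
  have : (-1) ^ k * Ring.choose t (k + 1) =
      (t / (k + 1)) * ((-1) ^ k * Ring.choose (t - 1) k) := by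
    rw [div_mul_eq_mul_div, eq_div_iff hk.ne']
    linear_combination (-1) ^ k * h
  rw [this]
  positivity

/-! ### Jacobi polynomials -/

theorem two_mul_halfPlus : (1 + X : ℝ[X]) = C 2 * (C (1 / 2) * (X + 1)) := by
  rw [← mul_assoc, ← C_mul]; norm_num; ring

theorem two_mul_halfMinus : (X - 1 : ℝ[X]) = C 2 * (C (1 / 2) * (X - 1)) := by
  rw [← mul_assoc, ← C_mul]; norm_num

theorem one_add_X_mul_derivative_term (c b : ℝ) (s k : ℕ) :
    (1 + X) * derivative (C c * (C (1 / 2) * (X - 1)) ^ s * (C (1 / 2) * (X + 1)) ^ k) +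
      C b * (C c * (C (1 / 2) * (X - 1)) ^ s * (C (1 / 2) * (X + 1)) ^ k) =
    C (c * s) * (C (1 / 2) * (X - 1)) ^ (s - 1) * (C (1 / 2) * (X + 1)) ^ (k + 1) +
      C (c * (k + b)) * (C (1 / 2) * (X - 1)) ^ s * (C (1 / 2) * (X + 1)) ^ k := by
  have hv : (k : ℝ[X]) * ((C (1 / 2) * (X + 1)) ^ (k - 1) * (C (1 / 2) * (X + 1))) =
      (k : ℝ[X]) * (C (1 / 2) * (X + 1)) ^ k := by
    rcases k with _ | k
    · simp
    · rw [Nat.add_sub_cancel, pow_succ]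
  have h2 : (C 2 : ℝ[X]) * C (1 / 2) = 1 := by rw [← C_mul]; norm_num
  simp only [derivative_mul, derivative_C, derivative_pow, derivative_add, derivative_sub,
    derivative_X, derivative_one, zero_mul, zero_add, add_zero, sub_zero, mul_one, C_mul, C_add,
    map_natCast]
  rw [two_mul_halfPlus]
  generalize (C (1 / 2) * (X - 1) : ℝ[X]) = u at *
  generalize (C (1 / 2) * (X + 1) : ℝ[X]) = v at *
  linear_combination (C c * (s : ℝ[X]) * u ^ (s - 1) * v ^ (k + 1) +
    C c * u ^ s * (k * v ^ k)) * h2 + (C 2 * C (1 / 2)) * C c * u ^ s * hv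

theorem X_sub_one_mul_derivative_term (c a : ℝ) (s k : ℕ) :
    (X - 1) * derivative (C c * (C (1 / 2) * (X - 1)) ^ s * (C (1 / 2) * (X + 1)) ^ k) +
      C a * (C c * (C (1 / 2) * (X - 1)) ^ s * (C (1 / 2) * (X + 1)) ^ k) =
    C (c * (s + a)) * (C (1 / 2) * (X - 1)) ^ s * (C (1 / 2) * (X + 1)) ^ k +
      C (c * k) * (C (1 / 2) * (X - 1)) ^ (s + 1) * (C (1 / 2) * (X + 1)) ^ (k - 1) := by
  have hv : (s : ℝ[X]) * ((C (1 / 2) * (X - 1)) ^ (s - 1) * (C (1 / 2) * (X - 1))) =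
      (s : ℝ[X]) * (C (1 / 2) * (X - 1)) ^ s := by
    rcases s with _ | s
    · simp
    · rw [Nat.add_sub_cancel, pow_succ]
  have h2 : (C 2 : ℝ[X]) * C (1 / 2) = 1 := by rw [← C_mul]; norm_num
  simp only [derivative_mul, derivative_C, derivative_pow, derivative_add, derivative_sub,
    derivative_X, derivative_one, zero_mul, zero_add, add_zero, sub_zero, mul_one, C_mul, C_add,
    map_natCast]
  nth_rewrite 1 [two_mul_halfMinus]
  generalize (C (1 / 2) * (X - 1) : ℝ[X]) = u at *
  generalize (C (1 / 2) * (X + 1) : ℝ[X]) = v at *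
  linear_combination (C c * (k : ℝ[X]) * v ^ (k - 1) * u ^ (s + 1) +
    C c * v ^ k * (s * u ^ s)) * h2 + (C 2 * C (1 / 2)) * C c * v ^ k * hv

/-- With u = (x - 1)/2 and v = (x + 1)/2, the operator (1 + x) d/dx sends u^s v^k to s u^(s-1)
v^(k+1) + k u^s v^k, so total degree is kept and coefficients can be compared. They match by
Pascal's rule and (s + 1) C(t, s + 1) = (t - s) C(t, s) = t C(t - 1, s). -/
theorem one_add_X_mul_derivative_jacobiPoly (a b : ℝ) (n : ℕ) :
    (1 + X) * derivative (jacobiPoly a b n) + C b * jacobiPoly a b n =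
      C ((n : ℝ) + b) * jacobiPoly (a + 1) (b - 1) n := by
  unfold jacobiPoly
  rw [derivative_sum, Finset.mul_sum, Finset.mul_sum, Finset.mul_sum, ← Finset.sum_add_distrib]
  simp only [one_add_X_mul_derivative_term]
  rw [Finset.sum_add_distrib, Finset.sum_range_succ']
  simp only [Nat.cast_zero, mul_zero, C_0, zero_mul, add_zero, Nat.add_sub_cancel]
  rw [Finset.sum_range_succ, Finset.sum_range_succ _ n, ← add_assoc, ← Finset.sum_add_distrib]
  congr 1
  · refine Finset.sum_congr rfl fun s hs => ?_
    have hs := Finset.mem_range.1 hs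
    obtain ⟨k, rfl⟩ : ∃ k, n = s + k + 1 := ⟨n - s - 1, by omega⟩
    have e1 : s + k + 1 - (s + 1) = k := by omega
    have e2 : s + k + 1 - s = k + 1 := by omega
    rw [e1, e2, ← add_mul, ← add_mul, ← C_add, ← mul_assoc, ← mul_assoc, ← C_mul]
    congr 3
    have h1 := choose_add_one_succ (((s + k + 1 : ℕ) : ℝ) + a) k
    have h2 := choose_succ_mul (((s + k + 1 : ℕ) : ℝ) + b) s
    have h3 := sub_mul_choose (((s + k + 1 : ℕ) : ℝ) + b) s
    rw [show ((s + k + 1 : ℕ) : ℝ) + (a + 1) = ((s + k + 1 : ℕ) : ℝ) + a + 1 by ring, h1,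
      show ((s + k + 1 : ℕ) : ℝ) + (b - 1) = ((s + k + 1 : ℕ) : ℝ) + b - 1 by ring]
    generalize Ring.choose (((s + k + 1 : ℕ) : ℝ) + a) k = A at *
    generalize Ring.choose (((s + k + 1 : ℕ) : ℝ) + a) (k + 1) = A' at *
    generalize Ring.choose (((s + k + 1 : ℕ) : ℝ) + b - 1) s = B'' at *
    generalize Ring.choose (((s + k + 1 : ℕ) : ℝ) + b) s = B at *
    generalize Ring.choose (((s + k + 1 : ℕ) : ℝ) + b) (s + 1) = B' at *
    push_cast at *
    linear_combination A * h2 + (A + A') * h3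
  · rw [← mul_assoc, ← mul_assoc, ← C_mul]
    congr 3
    have h3 := sub_mul_choose ((n : ℝ) + b) n
    rw [show (n : ℝ) + (b - 1) = (n : ℝ) + b - 1 by ring]
    simp only [Nat.sub_self, Ring.choose_zero_right, Nat.cast_zero, zero_add, one_mul]
    linear_combination h3

theorem X_sub_one_mul_derivative_jacobiPoly (a b : ℝ) (n : ℕ) :
    (X - 1) * derivative (jacobiPoly a b n) + C a * jacobiPoly a b n =
      C ((n : ℝ) + a) * jacobiPoly (a - 1) (b + 1) n := by
  unfold jacobiPoly
  rw [derivative_sum, Finset.mul_sum, Finset.mul_sum, Finset.mul_sum, ← Finset.sum_add_distrib]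
  simp only [X_sub_one_mul_derivative_term]
  rw [Finset.sum_add_distrib, Finset.sum_range_succ', Finset.sum_range_succ _ n,
    Finset.sum_range_succ' _ n]
  simp only [Nat.sub_self, Nat.cast_zero, mul_zero, C_0, zero_mul, add_zero]
  rw [add_right_comm, ← Finset.sum_add_distrib]
  congr 1
  · refine Finset.sum_congr rfl fun s hs => ?_
    have hs := Finset.mem_range.1 hs
    obtain ⟨k, rfl⟩ : ∃ k, n = s + k + 1 := ⟨n - s - 1, by omega⟩
    have e1 : s + k + 1 - (s + 1) = k := by omega
    have e2 : s + k + 1 - s = k + 1 := by omega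
    rw [e1, e2, Nat.add_sub_cancel, ← add_mul, ← add_mul, ← C_add, ← mul_assoc, ← mul_assoc,
      ← C_mul]
    congr 3
    have h1 := choose_add_one_succ (((s + k + 1 : ℕ) : ℝ) + b) s
    have h2 := choose_succ_mul (((s + k + 1 : ℕ) : ℝ) + a) k
    have h3 := sub_mul_choose (((s + k + 1 : ℕ) : ℝ) + a) k
    rw [show ((s + k + 1 : ℕ) : ℝ) + (b + 1) = ((s + k + 1 : ℕ) : ℝ) + b + 1 by ring, h1,
      show ((s + k + 1 : ℕ) : ℝ) + (a - 1) = ((s + k + 1 : ℕ) : ℝ) + a - 1 by ring]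
    generalize Ring.choose (((s + k + 1 : ℕ) : ℝ) + b) s = A at *
    generalize Ring.choose (((s + k + 1 : ℕ) : ℝ) + b) (s + 1) = A' at *
    generalize Ring.choose (((s + k + 1 : ℕ) : ℝ) + a - 1) k = B'' at *
    generalize Ring.choose (((s + k + 1 : ℕ) : ℝ) + a) k = B at *
    generalize Ring.choose (((s + k + 1 : ℕ) : ℝ) + a) (k + 1) = B' at *
    push_cast at *
    linear_combination A * h2 + (A + A') * h3
  · rw [← mul_assoc, ← mul_assoc, ← C_mul]
    congr 3
    have h3 := sub_mul_choose ((n : ℝ) + a) n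
    rw [show (n : ℝ) + (a - 1) = (n : ℝ) + a - 1 by ring]
    simp only [Nat.sub_zero, Ring.choose_zero_right, zero_add, mul_one]
    linear_combination h3

/-- The Jacobi differential equation. -/
theorem jacobiPoly_ode (a b : ℝ) (n : ℕ) :
    (1 - X ^ 2) * derivative (derivative (jacobiPoly a b n)) +
      (C (b - a) - C (a + b + 2) * X) * derivative (jacobiPoly a b n) +
      C (n * (n + a + b + 1)) * jacobiPoly a b n = 0 := by
  -- The two shifts undo each other up to a constant; eliminating the shifted polynomial and its
  -- derivative leaves a second-order equation.
  have h1 := one_add_X_mul_derivative_jacobiPoly a b n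
  have h2 := X_sub_one_mul_derivative_jacobiPoly (a + 1) (b - 1) n
  rw [add_sub_cancel_right, sub_add_cancel] at h2
  have h3 := congrArg derivative h1
  simp only [derivative_mul, derivative_add, derivative_one, derivative_X, derivative_C,
    zero_mul, zero_add, one_mul] at h3
  generalize derivative (derivative (jacobiPoly a b n)) = p2 at *
  generalize derivative (jacobiPoly a b n) = p1 at *
  generalize jacobiPoly a b n = p at *
  generalize derivative (jacobiPoly (a + 1) (b - 1) n) = q1 at *
  generalize jacobiPoly (a + 1) (b - 1) n = q at *
  simp only [C_add, C_mul, C_sub, map_natCast, C_1, map_ofNat] at *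
  linear_combination (1 - X) * h3 - (n + C b) * h2 - (C a + 1) * h1

theorem natDegree_halfMinus_pow_mul_le (s k : ℕ) :
    ((C (1 / 2) * (X - 1) : ℝ[X]) ^ s * (C (1 / 2) * (X + 1)) ^ k).natDegree ≤ s + k := by
  compute_degree

theorem coeff_halfMinus_pow_mul (s k : ℕ) :
    ((C (1 / 2) * (X - 1) : ℝ[X]) ^ s * (C (1 / 2) * (X + 1)) ^ k).coeff (s + k) =
      (1 / 2) ^ (s + k) := by
  have h1 : (X - 1 : ℝ[X]) = X - C 1 := by simp
  have h2 : (X + 1 : ℝ[X]) = X + C 1 := by simp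
  rw [mul_pow, mul_pow, mul_mul_mul_comm, ← pow_add, ← C_pow, coeff_C_mul, h1, h2]
  have hm := ((monic_X_sub_C (1 : ℝ)).pow s).mul ((monic_X_add_C (1 : ℝ)).pow k)
  have hd : ((X - C 1 : ℝ[X]) ^ s * (X + C 1) ^ k).natDegree = s + k := by
    rw [((monic_X_sub_C (1 : ℝ)).pow s).natDegree_mul ((monic_X_add_C (1 : ℝ)).pow k),
      natDegree_pow, natDegree_pow, natDegree_X_sub_C, natDegree_X_add_C, mul_one, mul_one]
  have := hm.coeff_natDegree
  rw [hd] at this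
  rw [this, mul_one]

theorem natDegree_jacobiPoly_le (a b : ℝ) (n : ℕ) : (jacobiPoly a b n).natDegree ≤ n := by
  refine natDegree_sum_le_of_forall_le _ _ fun s hs => ?_
  rw [mul_assoc]
  refine (natDegree_C_mul_le _ _).trans ((natDegree_halfMinus_pow_mul_le s (n - s)).trans ?_)
  have := Finset.mem_range.1 hs
  omega

/-- Every product u^s v^(n-s) contributes 2^(-n), and the binomial products sum by Vandermonde's
identity. -/
theorem coeff_jacobiPoly (a b : ℝ) (n : ℕ) :
    (jacobiPoly a b n).coeff n = (1 / 2) ^ n * Ring.choose (2 * n + a + b) n := by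
  have h : (2 * n + a + b : ℝ) = ((n : ℝ) + b) + ((n : ℝ) + a) := by ring
  rw [h, Ring.add_choose_eq n (Commute.all _ _),
    Finset.Nat.sum_antidiagonal_eq_sum_range_succ
      (fun i j => Ring.choose ((n : ℝ) + b) i * Ring.choose ((n : ℝ) + a) j), Finset.mul_sum]
  unfold jacobiPoly
  rw [finsetSum_coeff]
  refine Finset.sum_congr rfl fun s hs => ?_
  have hs := Finset.mem_range.1 hs
  have h2 := coeff_halfMinus_pow_mul s (n - s)
  rw [show s + (n - s) = n by omega] at h2
  rw [mul_assoc, coeff_C_mul, h2]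
  ring

theorem eval_one_jacobiPoly (a b : ℝ) (n : ℕ) :
    (jacobiPoly a b n).eval 1 = Ring.choose (n + a) n := by
  unfold jacobiPoly
  rw [eval_finsetSum, Finset.sum_range_succ', Finset.sum_eq_zero]
  · simp
    norm_num
  · intro i _
    simp

/-! ### The rational factorization -/

theorem one_sub_X_mul_derivative_xiPoly (a b : ℝ) (m : ℕ) :
    (1 - X) * derivative (xiPoly a b m) + C a * xiPoly a b m +
      C ((m : ℝ) - a) * xiPoly (a + 1) (b + 1) m = 0 := by
  have h := X_sub_one_mul_derivative_jacobiPoly (-a) b m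
  rw [C_neg, show (m : ℝ) + -a = m - a by ring, show -a - 1 = -(a + 1) by ring] at h
  unfold xiPoly
  linear_combination -h

theorem one_add_X_mul_derivative_xiPoly (a b : ℝ) (m : ℕ) :
    (1 + X) * derivative (xiPoly (a + 1) (b + 1) m) + C (b + 1) * xiPoly (a + 1) (b + 1) m =
      C (m + b + 1) * xiPoly a b m := by
  have h := one_add_X_mul_derivative_jacobiPoly (-(a + 1)) (b + 1) m
  rw [show -(a + 1) + 1 = -a by ring, add_sub_cancel_right, ← add_assoc] at h
  exact h

/-- The left factor of the factorization undoes `jacobiA` on Jacobi polynomials, up to the factor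
`ξ`. -/
theorem left_factor_jacobiA (a b : ℝ) (m j : ℕ) :
    (1 + X) * derivative (jacobiA a b m (jacobiPoly a b j)) +
        C (b + 1) * jacobiA a b m (jacobiPoly a b j) =
      C ((m - a - j) * (m + b + 1 + j)) * (xiPoly a b m * jacobiPoly a b j) := by
  have h1 := one_sub_X_mul_derivative_xiPoly a b m
  have h2 := one_add_X_mul_derivative_xiPoly a b m
  have h3 := jacobiPoly_ode a b j
  unfold jacobiA
  simp only [derivative_mul, derivative_add, derivative_sub, derivative_one, derivative_X,
    derivative_C, zero_mul, zero_add, zero_sub]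
  generalize derivative (derivative (jacobiPoly a b j)) = p2 at *
  generalize derivative (jacobiPoly a b j) = p1 at *
  generalize jacobiPoly a b j = p at *
  generalize derivative (xiPoly a b m) = x1 at *
  generalize xiPoly a b m = x at *
  generalize derivative (xiPoly (a + 1) (b + 1) m) = e1 at *
  generalize xiPoly (a + 1) (b + 1) m = e at *
  simp only [C_add, C_mul, C_sub, map_natCast, C_1, map_ofNat] at *
  -- The relations `h1` and `h2` remove ξ' and the shifted ξ; what remains is ξ times the Jacobi
  -- operator applied to P_j, plus a constant multiple of ξ P_j.
  linear_combination (1 + X) * p1 * h1 + (m - C a) * p * h2 + x * h3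

theorem natDegree_xiPoly_le (a b : ℝ) (m : ℕ) : (xiPoly a b m).natDegree ≤ m :=
  natDegree_jacobiPoly_le _ _ _

theorem natDegree_one_sub_X_le : (1 - X : ℝ[X]).natDegree ≤ 1 := by compute_degree

theorem natDegree_jacobiA_le (a b : ℝ) (m : ℕ) {j : ℕ} {p : ℝ[X]} (hp : p.natDegree ≤ j) :
    (jacobiA a b m p).natDegree ≤ m + j := by
  unfold jacobiA
  refine natDegree_add_le_of_degree_le ?_ ?_
  · rcases Nat.eq_zero_or_pos j with rfl | hj
    · rw [derivative_of_natDegree_zero (Nat.le_zero.1 hp)]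
      simp
    · have h1 := natDegree_mul_le_of_le natDegree_one_sub_X_le (natDegree_xiPoly_le a b m)
      have h2 : (derivative p).natDegree ≤ j - 1 :=
        (natDegree_derivative_le p).trans (Nat.sub_le_sub_right hp 1)
      have := natDegree_mul_le_of_le h1 h2
      omega
  · rw [mul_assoc]
    exact (natDegree_C_mul_le _ _).trans
      (natDegree_mul_le_of_le (natDegree_xiPoly_le _ _ _) hp)

/-- The top coefficients of the polynomials `(1 - X) q' + a q`. -/
theorem coeff_one_sub_X_mul_derivative {q : ℝ[X]} {n : ℕ} (hq : q.natDegree ≤ n) :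
    ((1 - X) * derivative q).coeff n = -(n * q.coeff n) := by
  rw [sub_mul, one_mul, coeff_sub, coeff_derivative,
    coeff_eq_zero_of_natDegree_lt (Nat.lt_succ_of_le hq)]
  rcases n with _ | n
  · simp
  · rw [coeff_X_mul, coeff_derivative]
    push_cast
    ring

theorem coeff_xiPoly_succ {a b : ℝ} {m : ℕ} (h : (m : ℝ) ≠ a) :
    (xiPoly (a + 1) (b + 1) m).coeff m = (xiPoly a b m).coeff m := by
  have h1 := congrArg (fun q => q.coeff m) (one_sub_X_mul_derivative_xiPoly a b m)
  simp only [coeff_add, coeff_C_mul, coeff_zero,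
    coeff_one_sub_X_mul_derivative (natDegree_xiPoly_le a b m)] at h1
  refine mul_left_cancel₀ (sub_ne_zero.2 h) ?_
  linear_combination h1

/-- The two ξ's have equal top coefficients, so the summands of `jacobiA` contribute the factors -j
and m - a to the same product. -/
theorem coeff_jacobiA {a b : ℝ} {m j : ℕ} (h : (m : ℝ) ≠ a) {p : ℝ[X]} (hp : p.natDegree ≤ j) :
    (jacobiA a b m p).coeff (m + j) = (m - a - j) * ((xiPoly a b m).coeff m * p.coeff j) := by
  have h1 : ((1 - X) * derivative p).natDegree ≤ j := by
    rcases Nat.eq_zero_or_pos j with rfl | hj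
    · rw [derivative_of_natDegree_zero (Nat.le_zero.1 hp)]
      simp
    · have h2 : (derivative p).natDegree ≤ j - 1 :=
        (natDegree_derivative_le p).trans (Nat.sub_le_sub_right hp 1)
      have := natDegree_mul_le_of_le natDegree_one_sub_X_le h2
      omega
  have e : jacobiA a b m p = xiPoly a b m * ((1 - X) * derivative p) +
      C ((m : ℝ) - a) * (xiPoly (a + 1) (b + 1) m * p) := by
    unfold jacobiA; ring
  rw [e, coeff_add, coeff_C_mul,
    coeff_mul_add_eq_of_natDegree_le (natDegree_xiPoly_le a b m) h1,
    coeff_mul_add_eq_of_natDegree_le (natDegree_xiPoly_le _ _ m) hp,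
    coeff_one_sub_X_mul_derivative hp, coeff_xiPoly_succ h]
  ring

/-! ### Absence of zeros -/

/-- Since (x - 1)/2 = -(1 - x)/2, the hypothesis turns the defining sum, times σ, into a sum of
nonnegative terms on [-1, 1]. The term s = n is positive for x < 1, and s = 0 is positive at x = 1.
-/
theorem jacobiPoly_eval_ne_zero_of_sign {a b σ : ℝ} {n : ℕ}
    (h : ∀ s ≤ n, 0 < σ * (-1) ^ s *
      (Ring.choose ((n : ℝ) + a) (n - s) * Ring.choose ((n : ℝ) + b) s))
    {x : ℝ} (hx : x ∈ Set.Icc (-1 : ℝ) 1) : (jacobiPoly a b n).eval x ≠ 0 := by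
  suffices 0 < σ * (jacobiPoly a b n).eval x by
    intro h0
    rw [h0, mul_zero] at this
    exact lt_irrefl _ this
  obtain ⟨hx1, hx2⟩ := hx
  unfold jacobiPoly
  rw [eval_finsetSum, Finset.mul_sum]
  have key : ∀ s, σ * eval x (C (Ring.choose ((n : ℝ) + a) (n - s) *
        Ring.choose ((n : ℝ) + b) s) *
        (C (1 / 2) * (X - 1)) ^ s * (C (1 / 2) * (X + 1)) ^ (n - s)) =
      (σ * (-1) ^ s * (Ring.choose ((n : ℝ) + a) (n - s) * Ring.choose ((n : ℝ) + b) s)) *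
        (((1 - x) / 2) ^ s * ((1 + x) / 2) ^ (n - s)) := by
    intro s
    simp only [eval_mul, eval_C, eval_pow, eval_sub, eval_add, eval_X, eval_one]
    rw [show (1 / 2 * (x - 1) : ℝ) = (-1) * ((1 - x) / 2) by ring, mul_pow,
      show (1 / 2 * (x + 1) : ℝ) = (1 + x) / 2 by ring]
    ring
  simp only [key]
  have hu : 0 ≤ (1 - x) / 2 := by linarith
  have hv : 0 ≤ (1 + x) / 2 := by linarith
  refine Finset.sum_pos' (fun s hs => ?_) ?_
  · have := h s (Nat.lt_succ_iff.1 (Finset.mem_range.1 hs))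
    positivity
  · rcases lt_or_ge x 1 with h1 | h1
    · refine ⟨n, Finset.self_mem_range_succ n, mul_pos (h n le_rfl) ?_⟩
      have : 0 < (1 - x) / 2 := by linarith
      simp only [Nat.sub_self, pow_zero, mul_one]
      positivity
    · refine ⟨0, by simp, mul_pos (h 0 (Nat.zero_le n)) ?_⟩
      have : 0 < (1 + x) / 2 := by linarith
      simp only [Nat.sub_zero, pow_zero, one_mul]
      positivity

theorem neg_one_pow_sub_mul {n s : ℕ} (hs : s ≤ n) : ((-1 : ℝ)) ^ (n - s) = (-1) ^ n * (-1) ^ s := by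
  obtain ⟨k, rfl⟩ := Nat.exists_eq_add_of_le hs
  rw [Nat.add_sub_cancel_left, pow_add, mul_right_comm, ← mul_pow]
  norm_num

theorem xiPoly_eval_ne_zero {m : ℕ} (hm : m ≠ 0) {α β : ℝ} (hβ : -1 < β)
    (hαm : (m : ℝ) - 2 < α)
    (hsign : SignType.sign (α - (m : ℝ) + 1) = SignType.sign β) (hα : α ≠ (m : ℝ) - 1)
    {x : ℝ} (hx : x ∈ Set.Icc (-1 : ℝ) 1) :
    (xiPoly (α + 1) (β - 1) m).eval x ≠ 0 := by
  unfold xiPoly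
  rcases lt_or_gt_of_ne hα with h | h
  -- Here m - α - 1 lies in (0, 1), so C(m - α - 1, m - s) has sign (-1)^(m-s-1) for s < m and
  -- equals 1 for s = m. This break in the alternation is repaired by C(m + β - 1, s), which is
  -- positive for s < m but negative for s = m, its last factor being β.
  · have hβ0 : β < 0 := by
      rw [sign_neg (by linarith)] at hsign
      exact sign_eq_neg_one_iff.1 hsign.symm
    refine jacobiPoly_eval_ne_zero_of_sign (σ := (-1) ^ (m + 1)) (fun s hs => ?_) hx
    rcases hs.lt_or_eq with h1 | rfl
    · obtain ⟨k, rfl⟩ : ∃ k, m = s + k + 1 := ⟨m - s - 1, by omega⟩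
      push_cast at *
      have e := neg_one_pow_mul_choose_succ_pos (t := (s : ℝ) + k + 1 + (-(α + 1)))
        (by linarith) (by linarith) k
      have e2 : 0 < Ring.choose ((s : ℝ) + k + 1 + (β - 1)) s :=
        choose_pos_of_lt (by linarith [(k.cast_nonneg : (0 : ℝ) ≤ k)])
      rw [show s + k + 1 - s = k + 1 by omega]
      have e3 : ((-1 : ℝ)) ^ (s + k + 1 + 1) * (-1) ^ s = (-1) ^ k := by
        rw [show s + k + 1 + 1 = k + (s + 2) by omega, pow_add, pow_add, mul_assoc, mul_right_comm,
          ← mul_pow]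
        norm_num
      rw [e3, ← mul_assoc]
      exact mul_pos e e2
    · rw [Nat.sub_self, Ring.choose_zero_right, one_mul, pow_succ, mul_right_comm _ (-1 : ℝ), ← mul_pow]
      obtain ⟨k, rfl⟩ := Nat.exists_eq_succ_of_ne_zero hm
      have h4 := choose_succ_mul (((k + 1 : ℕ) : ℝ) + (β - 1)) k
      have e2 : 0 < Ring.choose (((k + 1 : ℕ) : ℝ) + (β - 1)) k :=
        choose_pos_of_lt (by push_cast; linarith)
      have h5 : (((k + 1 : ℕ) : ℝ) + (β - 1) - k) = β := by push_cast; ring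
      rw [h5] at h4
      have h6 : ((k : ℝ) + 1) * Ring.choose (((k + 1 : ℕ) : ℝ) + (β - 1)) (k + 1) < 0 := by
        rw [h4]; exact mul_neg_of_neg_of_pos hβ0 e2
      have h7 := (pos_iff_neg_of_mul_neg h6).1 (by positivity)
      norm_num
      simpa using h7
  -- Now m - α - 1 < 0, so the first binomial coefficient alternates in sign throughout, while the
  -- second stays positive.
  · have hβ0 : 0 < β := by
      rw [sign_pos (by linarith)] at hsign
      exact sign_eq_one_iff.1 hsign.symm
    refine jacobiPoly_eval_ne_zero_of_sign (σ := (-1) ^ m) (fun s hs => ?_) hx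
    have e := neg_one_pow_mul_choose_pos (t := (m : ℝ) + (-(α + 1))) (by linarith) (m - s)
    have e2 : 0 < Ring.choose ((m : ℝ) + (β - 1)) s := choose_pos_of_lt (by
      have : (s : ℝ) ≤ m := by exact_mod_cast hs
      linarith)
    rw [neg_one_pow_sub_mul hs] at e
    rw [← mul_assoc]
    exact mul_pos e e2

/-! ### The exceptional polynomials -/

theorem xmJacobi_eval_one {α : ℝ} (hα : -1 < α) (β : ℝ) {m n : ℕ} (hmn : m ≤ n) :
    (xmJacobi α β m n).eval 1 = Ring.choose (α + n - m) n * (n.choose m : ℝ) := by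
  obtain ⟨j, rfl⟩ := Nat.exists_eq_add_of_le hmn
  have hpos : 0 < α + 1 + (j : ℝ) := by
    have : (0 : ℝ) ≤ j := j.cast_nonneg
    linarith
  unfold xmJacobi jacobiA xiPoly
  simp only [eval_mul, eval_add, eval_sub, eval_C, eval_X, eval_one, sub_self, zero_mul, zero_add,
    eval_one_jacobiPoly, Nat.add_sub_cancel_left]
  rw [show α + ((m + j : ℕ) : ℝ) - m = α + j by push_cast; ring,
    Nat.cast_choose ℝ (Nat.le_add_right m j), Nat.add_sub_cancel_left]
  have h1 := choose_eq_prod_div (α + j) (m + j)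
  have h2 := choose_eq_prod_div (j + (α + 1)) j
  have h3 := choose_eq_prod_div (m + -(α + 1 + 1)) m
  have e1 := Finset.prod_range_add (fun i : ℕ => α + j - i) j m
  -- Both sides are the product of m - (α + 1) - i over 0 ≤ i ≤ m, read in opposite orders with
  -- every factor negated.
  have e3 : (m - (α + 1)) * ∏ i ∈ Finset.range m, ((m : ℝ) + -(α + 1 + 1) - i) =
      (-1) ^ (m + 1) * ((α + 1) * ∏ i ∈ Finset.range m, (α - i)) := by
    have f1 := Finset.prod_range_succ' (fun i : ℕ => (m : ℝ) - (α + 1) - i) m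
    have f2 := Finset.prod_range_succ' (fun i : ℕ => α + 1 - (i : ℝ)) m
    have f3 := Finset.prod_range_reflect (fun i : ℕ => α + 1 - (i : ℝ)) (m + 1)
    have f4 : ∏ i ∈ Finset.range (m + 1), ((m : ℝ) - (α + 1) - i) =
        (-1) ^ (m + 1) * ∏ i ∈ Finset.range (m + 1), (α + 1 - ((m + 1 - 1 - i : ℕ) : ℝ)) := by
      have : ((-1 : ℝ)) ^ (m + 1) = ∏ i ∈ Finset.range (m + 1), (-1 : ℝ) := by simp
      rw [this, ← Finset.prod_mul_distrib]
      refine Finset.prod_congr rfl fun i hi => ?_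
      have hi := Finset.mem_range.1 hi
      rw [Nat.add_sub_cancel, Nat.cast_sub (by omega)]
      ring
    rw [f3, f2, f1] at f4
    simp only [Nat.cast_zero, sub_zero] at f4
    have g1 : ∏ i ∈ Finset.range m, ((m : ℝ) - (α + 1) - ((i + 1 : ℕ) : ℝ)) =
        ∏ i ∈ Finset.range m, ((m : ℝ) + -(α + 1 + 1) - i) :=
      Finset.prod_congr rfl fun i _ => by push_cast; ring
    have g2 : ∏ i ∈ Finset.range m, (α + 1 - ((i + 1 : ℕ) : ℝ)) =
        ∏ i ∈ Finset.range m, (α - i) :=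
      Finset.prod_congr rfl fun i _ => by push_cast; ring
    rw [g1, g2] at f4
    linear_combination f4
  -- The product of j + α + 1 - i over 0 ≤ i ≤ j, with its last or its first factor split off.
  have e4 : (α + 1) * ∏ i ∈ Finset.range j, ((j : ℝ) + (α + 1) - i) =
      (α + 1 + j) * ∏ i ∈ Finset.range j, (α + j - i) := by
    have f1 := Finset.prod_range_succ (fun i : ℕ => (j : ℝ) + (α + 1) - i) j
    rw [Finset.prod_range_succ'] at f1
    have g1 : ∏ i ∈ Finset.range j, ((j : ℝ) + (α + 1) - ((i + 1 : ℕ) : ℝ)) =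
        ∏ i ∈ Finset.range j, (α + j - i) :=
      Finset.prod_congr rfl fun i _ => by push_cast; ring
    rw [g1] at f1
    simp only [Nat.cast_zero, sub_zero] at f1
    linear_combination -f1
  have e5 : ∏ i ∈ Finset.range m, (α + j - ((j + i : ℕ) : ℝ)) =
      ∏ i ∈ Finset.range m, (α - i) :=
    Finset.prod_congr rfl fun i _ => by push_cast; ring
  rw [e5] at e1
  rw [h1, h2, h3, add_comm m j, e1]
  have hs : ((-1 : ℝ)) ^ (m + 1) * (-1) ^ (m + 1) = 1 := by
    rw [← mul_pow]; norm_num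
  generalize ∏ i ∈ Finset.range m, (α - (i : ℝ)) = Q at *
  generalize ∏ i ∈ Finset.range m, ((m : ℝ) + -(α + 1 + 1) - i) = M at *
  generalize ∏ i ∈ Finset.range j, ((j : ℝ) + (α + 1) - i) = J at *
  generalize ∏ i ∈ Finset.range j, (α + j - (i : ℝ)) = R at *
  generalize ((-1 : ℝ)) ^ (m + 1) = σ at *
  have hj : (j.factorial : ℝ) ≠ 0 := by positivity
  have hm' : (m.factorial : ℝ) ≠ 0 := by positivity
  have hn : ((j + m).factorial : ℝ) ≠ 0 := by positivity
  have := hpos.ne'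
  field_simp
  linear_combination σ * J * e3 + Q * σ * σ * e4 + (α + 1 + j) * R * Q * hs

theorem left_factor_xmJacobi (α β : ℝ) (m k : ℕ) :
    (1 + X) * derivative (xmJacobi α β m (m + k)) + C β * xmJacobi α β m (m + k) =
      C ((-1) ^ (m + 1) / (α + 1 + k) * ((m - (α + 1) - k) * (m + β + k))) *
        (xiPoly (α + 1) (β - 1) m * jacobiPoly (α + 1) (β - 1) k) := by
  have h := left_factor_jacobiA (α + 1) (β - 1) m k
  unfold xmJacobi
  rw [Nat.add_sub_cancel_left, derivative_C_mul, C_mul]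
  rw [sub_add_cancel, show (m : ℝ) + (β - 1) + 1 + k = m + β + k by ring] at h
  linear_combination C ((-1) ^ (m + 1) / (α + 1 + (k : ℝ))) * h

theorem xmJacobi_mem_xmSubspace (α β : ℝ) (m k : ℕ) :
    xmJacobi α β m (m + k) ∈ xmSubspace α β m := by
  change jacobiPoly (-α - 1) (β - 1) m ∣ _
  rw [left_factor_xmJacobi, show -α - 1 = -(α + 1) by ring]
  exact (Dvd.intro _ rfl).mul_left _

theorem natDegree_xmJacobi_le (α β : ℝ) (m k : ℕ) :
    (xmJacobi α β m (m + k)).natDegree ≤ m + k := by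
  unfold xmJacobi
  rw [Nat.add_sub_cancel_left]
  exact (natDegree_C_mul_le _ _).trans (natDegree_jacobiA_le _ _ _ (natDegree_jacobiPoly_le _ _ _))

theorem coeff_xiPoly_ne_zero {α β : ℝ} {m : ℕ}
    (h : ∀ i : ℕ, i < m → α - β - (m : ℝ) + 1 ≠ (i : ℝ)) :
    (xiPoly (α + 1) (β - 1) m).coeff m ≠ 0 := by
  unfold xiPoly
  rw [coeff_jacobiPoly]
  refine mul_ne_zero (by positivity) (choose_ne_zero fun i hi he => ?_)
  -- The binomial coefficient vanishes when 2m - α + β - 2 = i, that is, when α - β - m + 1 = m - 1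
  -- - i.
  refine h (m - 1 - i) (by omega) ?_
  rw [Nat.cast_sub (by omega), Nat.cast_sub (by omega)]
  push_cast
  linarith

theorem coeff_xmJacobi_ne_zero {α β : ℝ} {m : ℕ} (hm : 1 < m) (hβ : -1 < β)
    (hαm : (m : ℝ) - 2 < α)
    (hnonsing : ∀ i : ℕ, i < m → α ≠ (i : ℝ) ∧ α - β - (m : ℝ) + 1 ≠ (i : ℝ)) (k : ℕ) :
    (xmJacobi α β m (m + k)).coeff (m + k) ≠ 0 := by
  have hm2 : (2 : ℝ) ≤ m := by exact_mod_cast hm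
  have hα0 : 0 < α := by linarith
  have hk : (0 : ℝ) ≤ k := k.cast_nonneg
  unfold xmJacobi
  -- A zero means α = m - 1 - k: an excluded value for k < m, and incompatible with α > 0 for k ≥ m.
  have h0 : (m : ℝ) - (α + 1) - k ≠ 0 := by
    intro h
    rcases lt_or_ge k m with hkm | hkm
    · refine (hnonsing (m - 1 - k) (by omega)).1 ?_
      rw [Nat.cast_sub (by omega), Nat.cast_sub (by omega)]
      push_cast
      linarith
    · have : (m : ℝ) ≤ k := by exact_mod_cast hkm
      linarith
  have h1 : (m : ℝ) ≠ α + 1 := by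
    intro h
    refine (hnonsing (m - 1) (by omega)).1 ?_
    rw [Nat.cast_sub (by omega)]
    push_cast
    linarith
  rw [Nat.add_sub_cancel_left, coeff_C_mul, coeff_jacobiA h1 (natDegree_jacobiPoly_le _ _ _)]
  refine mul_ne_zero (div_ne_zero (by simp) (by linarith)) (mul_ne_zero h0 (mul_ne_zero
    (coeff_xiPoly_ne_zero fun i hi => (hnonsing i hi).2) ?_))
  rw [coeff_jacobiPoly]
  refine mul_ne_zero (by positivity) (choose_ne_zero fun i hi he => ?_)
  have : (i : ℝ) + 1 ≤ k := by exact_mod_cast hi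
  have : (1 : ℝ) ≤ k := by linarith [(i.cast_nonneg : (0 : ℝ) ≤ i)]
  linarith

/-! ### Flags spanned by polynomials of increasing degrees -/

theorem linearIndependent_of_natDegree_injective {ι : Type*} {z : ι → ℝ[X]}
    (h0 : ∀ i, z i ≠ 0) (hz : Function.Injective fun i => (z i).natDegree) :
    LinearIndependent ℝ z := by
  rw [linearIndependent_iff']
  intro s g hg i hi
  have hdeg : ∀ i, g i ≠ 0 → (g i • z i).degree = ((z i).natDegree : WithBot ℕ) := fun i hgi => by
    rw [smul_eq_C_mul, degree_C_mul hgi, degree_eq_natDegree (h0 i)]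
  have hpair : Set.Pairwise {i | i ∈ s ∧ g i • z i ≠ 0}
      (Function.onFun Ne (degree ∘ fun i => g i • z i)) := by
    rintro i ⟨_, hi⟩ j ⟨_, hj⟩ hij h
    have hgi : g i ≠ 0 := fun h => hi (by simp [h])
    have hgj : g j ≠ 0 := fun h => hj (by simp [h])
    simp only [Function.comp_apply, hdeg i hgi, hdeg j hgj] at h
    exact hij (hz (by exact_mod_cast h))
  have hsum := degree_sum_eq_of_disjoint _ s hpair
  rw [hg, degree_zero] at hsum
  by_contra hgi
  have h1 := Finset.le_sup (f := fun i => (g i • z i).degree) hi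
  rw [← hsum, hdeg i hgi] at h1
  simp at h1

/-- A sequence of elements of `U` of degrees `m, m + 1, …`, in a space `U` without nonzero elements
of degree less than `m`. -/
structure IsDegreeBasis (U : Submodule ℝ ℝ[X]) (m : ℕ) (y : ℕ → ℝ[X]) : Prop where
  mem : ∀ k, y k ∈ U
  natDegree_le : ∀ k, (y k).natDegree ≤ m + k
  coeff_ne_zero : ∀ k, (y k).coeff (m + k) ≠ 0
  eq_zero : ∀ q ∈ U, q.natDegree < m → q = 0

namespace IsDegreeBasis

variable {U : Submodule ℝ ℝ[X]} {m : ℕ} {y : ℕ → ℝ[X]}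

theorem ne_zero (h : IsDegreeBasis U m y) (k : ℕ) : y k ≠ 0 := fun h0 =>
  h.coeff_ne_zero k (by rw [h0, coeff_zero])

theorem natDegree_eq (h : IsDegreeBasis U m y) (k : ℕ) : (y k).natDegree = m + k :=
  le_antisymm (h.natDegree_le k) (le_natDegree_of_ne_zero (h.coeff_ne_zero k))

theorem linearIndependent (h : IsDegreeBasis U m y) : LinearIndependent ℝ y :=
  linearIndependent_of_natDegree_injective h.ne_zero fun i j hij => by
    simpa [h.natDegree_eq] using hij

/-- Division by leading terms: subtracting a multiple of `y k` removes the coefficient of degree m +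
k. The descent ends below degree m, where `U` contains only 0. -/
theorem mem_span (h : IsDegreeBasis U m y) {q : ℝ[X]} (hq : q ∈ U) (k : ℕ)
    (hk : q.natDegree < m + k) : q ∈ Submodule.span ℝ (y '' Set.Iio k) := by
  induction k generalizing q with
  | zero => rw [h.eq_zero q hq hk]; exact Submodule.zero_mem _
  | succ k ih =>
    set c := q.coeff (m + k) / (y k).coeff (m + k)
    have hr : q - c • y k ∈ Submodule.span ℝ (y '' Set.Iio k) := by
      by_cases hz : q - c • y k = 0
      · rw [hz]; exact Submodule.zero_mem _
      have hmem : q - c • y k ∈ U := U.sub_mem hq (U.smul_mem c (h.mem k))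
      have hle : (q - c • y k).natDegree ≤ m + k := by
        refine (natDegree_sub_le q (c • y k)).trans (max_le (Nat.lt_succ_iff.1 hk) ?_)
        exact (natDegree_smul_le c (y k)).trans (h.natDegree_le k)
      refine ih hmem (lt_of_le_of_ne hle fun he => ?_)
      have hc : (q - c • y k).coeff (m + k) = 0 := by
        rw [coeff_sub, coeff_smul, smul_eq_mul, div_mul_cancel₀ _ (h.coeff_ne_zero k), sub_self]
      rw [← he, coeff_natDegree, leadingCoeff_eq_zero] at hc
      exact hz hc
    have hmono : Submodule.span ℝ (y '' Set.Iio k) ≤ Submodule.span ℝ (y '' Set.Iio (k + 1)) :=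
      Submodule.span_mono (Set.image_mono (Set.Iio_subset_Iio (Nat.le_succ k)))
    have := Submodule.add_mem _ (hmono hr) (Submodule.smul_mem _ c
      (Submodule.subset_span (Set.mem_image_of_mem y (Set.mem_Iio.2 (Nat.lt_succ_self k)))))
    rwa [sub_add_cancel] at this

theorem mem_span_Iic_iff (h : IsDegreeBasis U m y) {q : ℝ[X]} {k : ℕ} :
    q ∈ Submodule.span ℝ (y '' Set.Iic k) ↔ q ∈ U ∧ q.natDegree ≤ m + k := by
  constructor
  · intro hq
    have : Submodule.span ℝ (y '' Set.Iic k) ≤ U ⊓ degreeLE ℝ ((m + k : ℕ) : WithBot ℕ) := by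
      rw [Submodule.span_le]
      rintro _ ⟨i, hi, rfl⟩
      refine ⟨h.mem i, mem_degreeLE.2 (degree_le_of_natDegree_le ?_)⟩
      rw [h.natDegree_eq]
      exact Nat.add_le_add_left (Set.mem_Iic.1 hi) m
    have := this hq
    exact ⟨this.1, natDegree_le_of_degree_le (mem_degreeLE.1 this.2)⟩
  · rintro ⟨hq, hk⟩
    have := h.mem_span hq (k + 1) (by omega)
    rwa [Set.Iio_add_one_eq_Iic] at this

theorem span_range (h : IsDegreeBasis U m y) : Submodule.span ℝ (Set.range y) = U := by
  refine le_antisymm (Submodule.span_le.2 ?_) fun q hq => ?_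
  · rintro _ ⟨i, rfl⟩
    exact h.mem i
  · exact Submodule.span_mono (Set.image_subset_range _ _)
      (h.mem_span_Iic_iff.2 ⟨hq, Nat.le_add_left q.natDegree m⟩)

end IsDegreeBasis

theorem finrank_span_image_Iic {y : ℕ → ℝ[X]} (hy : LinearIndependent ℝ y) (k : ℕ) :
    Module.finrank ℝ (Submodule.span ℝ (y '' Set.Iic k)) = k + 1 := by
  have e : y '' Set.Iic k = Set.range fun i : Fin (k + 1) => y i := by
    ext q
    constructor
    · rintro ⟨i, hi, rfl⟩
      exact ⟨⟨i, Nat.lt_succ_of_le hi⟩, rfl⟩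
    · rintro ⟨i, rfl⟩
      exact ⟨i, Nat.lt_succ_iff.1 i.2, rfl⟩
  have := finrank_span_eq_card (hy.comp (Fin.val : Fin (k + 1) → ℕ) Fin.val_injective)
  rw [Fintype.card_fin] at this
  rw [e]
  exact this

/-! ### Degrees of the spaces of a flag -/

namespace PolynomialFlag

theorem ext_space {F G : PolynomialFlag} (h : ∀ k, F.space k = G.space k) : F = G := by
  cases F; cases G
  congr
  exact funext h

instance (F : PolynomialFlag) (k : ℕ) : Module.Finite ℝ (F.space k) :=
  Module.finite_of_finrank_pos (by rw [F.finrank_space]; exact Nat.succ_pos k)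

theorem bddAbove_natDegree (F : PolynomialFlag) (k : ℕ) :
    BddAbove (Polynomial.natDegree '' (F.space k : Set ℝ[X])) := by
  obtain ⟨s, hs⟩ := (Module.Finite.iff_fg (N := F.space k)).1 inferInstance
  refine ⟨s.sup natDegree, ?_⟩
  rintro _ ⟨q, hq, rfl⟩
  have : F.space k ≤ degreeLE ℝ ((s.sup natDegree : ℕ) : WithBot ℕ) := by
    rw [← hs, Submodule.span_le]
    intro p hp
    exact mem_degreeLE.2 (degree_le_of_natDegree_le (Finset.le_sup (f := natDegree) hp))
  exact natDegree_le_of_degree_le (mem_degreeLE.1 (this hq))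

theorem natDegree_le_degree (F : PolynomialFlag) {k : ℕ} {q : ℝ[X]} (hq : q ∈ F.space k) :
    q.natDegree ≤ F.degree k :=
  le_csSup (F.bddAbove_natDegree k) ⟨q, hq, rfl⟩

theorem exists_natDegree_eq (F : PolynomialFlag) (k : ℕ) :
    ∃ q ∈ F.space k, q ≠ 0 ∧ q.natDegree = F.degree k := by
  obtain ⟨q, hq, hqd⟩ : F.degree k ∈ Polynomial.natDegree '' (F.space k : Set ℝ[X]) :=
    Nat.sSup_mem ⟨0, 0, Submodule.zero_mem _, natDegree_zero⟩ (F.bddAbove_natDegree k)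
  -- As `natDegree 0 = 0`, the maximum may be realized by the zero polynomial; it is then 0, and any
  -- nonzero element attains it too.
  by_cases h0 : q = 0
  · have hne : F.space k ≠ ⊥ := fun h => by
      have := F.finrank_space k
      rw [h, finrank_bot] at this
      omega
    obtain ⟨p, hp, hp0⟩ := Submodule.exists_mem_ne_zero_of_ne_bot hne
    refine ⟨p, hp, hp0, le_antisymm (F.natDegree_le_degree hp) ?_⟩
    rw [← hqd, h0, natDegree_zero]
    exact Nat.zero_le _
  · exact ⟨q, hq, h0, hqd⟩

/-- The flag spanned by a linearly independent sequence. -/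
noncomputable def ofLinearIndependent (y : ℕ → ℝ[X]) (hy : LinearIndependent ℝ y) :
    PolynomialFlag where
  space k := Submodule.span ℝ (y '' Set.Iic k)
  mono _ _ hij := Submodule.span_mono (Set.image_mono (Set.Iic_subset_Iic.2 hij))
  finrank_space k := finrank_span_image_Iic hy k

end PolynomialFlag

/-! ### Existence and uniqueness of the degree-regular flag -/

namespace IsDegreeBasis

variable {U : Submodule ℝ ℝ[X]} {m : ℕ} {y : ℕ → ℝ[X]}

/-- The flag spanned by a degree basis. -/
noncomputable def flag (h : IsDegreeBasis U m y) : PolynomialFlag :=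
  PolynomialFlag.ofLinearIndependent y h.linearIndependent

theorem mem_flag (h : IsDegreeBasis U m y) {q : ℝ[X]} {k : ℕ} :
    q ∈ h.flag.space k ↔ q ∈ U ∧ q.natDegree ≤ m + k := h.mem_span_Iic_iff

theorem degree_flag (h : IsDegreeBasis U m y) (k : ℕ) : h.flag.degree k = m + k := by
  refine le_antisymm ?_ ?_
  · obtain ⟨q, hq, -, hd⟩ := h.flag.exists_natDegree_eq k
    rw [← hd]
    exact (h.mem_flag.1 hq).2
  · rw [← h.natDegree_eq k]
    exact h.flag.natDegree_le_degree (h.mem_flag.2 ⟨h.mem k, h.natDegree_le k⟩)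

theorem hasStableCodim_flag (h : IsDegreeBasis U m y) : h.flag.HasStableCodim m := fun k => by
  unfold PolynomialFlag.codim
  rw [h.degree_flag, h.flag.finrank_space]
  push_cast
  ring

theorem exhausts_flag (h : IsDegreeBasis U m y) : h.flag.Exhausts U := by
  refine ⟨fun i j hij => ?_, ?_⟩
  · rw [h.degree_flag, h.degree_flag]
    omega
  · refine le_antisymm (iSup_le fun k q hq => (h.mem_flag.1 hq).1) fun q hq => ?_
    exact (le_iSup h.flag.space q.natDegree)
      (h.mem_flag.2 ⟨hq, Nat.le_add_left q.natDegree m⟩)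

/-- If the k-th degree exceeded m + k, then y_0, …, y_k followed by elements of `G` of top degrees
in the spaces k, …, L would have strictly increasing degrees. For L large these are L + 2
independent elements of a space of dimension L + 1. -/
theorem degree_le_of_exhausts (h : IsDegreeBasis U m y) {G : PolynomialFlag} (hG : G.Exhausts U)
    (k : ℕ) : G.degree k ≤ m + k := by
  by_contra! hlt
  obtain ⟨hreg, hU⟩ := hG
  have hex : ∀ i, ∃ l, y i ∈ G.space l := fun i => by
    have := h.mem i
    rw [← hU] at this
    exact (Submodule.mem_iSup_of_directed _ G.mono.directed_le).1 this
  choose l hl using hex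
  choose q hq hq0 hqd using G.exists_natDegree_eq
  -- Large enough for y_0, …, y_k all to lie in `G.space L`, and at least k.
  set L := k + (Finset.range (k + 1)).sup l with hL
  have hlL : ∀ i ≤ k, l i ≤ L := fun i hi =>
    (Finset.le_sup (f := l) (Finset.mem_range.2 (Nat.lt_succ_of_le hi))).trans
      (Nat.le_add_left _ _)
  let z : ℕ → ℝ[X] := fun i => if i ≤ k then y i else q (i - 1)
  have hzmono : StrictMono fun i => (z i).natDegree := by
    refine strictMono_nat_of_lt_succ fun i => ?_
    rcases lt_trichotomy i k with hi | rfl | hi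
    · simp only [z, if_pos hi.le, if_pos (Nat.succ_le_of_lt hi), h.natDegree_eq]
      omega
    · simp only [z, if_pos le_rfl, if_neg (Nat.not_succ_le_self i), h.natDegree_eq, hqd,
        Nat.add_sub_cancel]
      exact hlt
    · simp only [z, if_neg (not_le.2 hi), if_neg (not_le.2 (hi.trans (Nat.lt_succ_self i))), hqd]
      exact hreg (by omega)
  have hz0 : ∀ i, z i ≠ 0 := fun i => by
    simp only [z]
    split_ifs
    exacts [h.ne_zero i, hq0 _]
  have hzL : ∀ i ≤ L + 1, z i ∈ G.space L := fun i hi => by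
    simp only [z]
    split_ifs with hik
    · exact G.mono (hlL i hik) (hl i)
    · exact G.mono (by omega) (hq (i - 1))
  have hle : Submodule.span ℝ (z '' Set.Iic (L + 1)) ≤ G.space L := by
    rw [Submodule.span_le]
    rintro _ ⟨i, hi, rfl⟩
    exact hzL i hi
  have hfin := Submodule.finrank_mono hle
  rw [finrank_span_image_Iic (linearIndependent_of_natDegree_injective hz0 hzmono.injective),
    G.finrank_space] at hfin
  omega

/-- The degree bound puts each space of `G` inside the corresponding space of `h.flag`, and their
dimensions agree. -/
theorem exhausts_iff (h : IsDegreeBasis U m y) (G : PolynomialFlag) :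
    G.Exhausts U ↔ G = h.flag := by
  refine ⟨fun hG => PolynomialFlag.ext_space fun k => ?_, fun hG => hG ▸ h.exhausts_flag⟩
  refine Submodule.eq_of_le_of_finrank_eq (fun q hq => h.mem_flag.2 ⟨?_, ?_⟩) ?_
  · rw [← hG.2]
    exact le_iSup G.space k hq
  · exact (G.natDegree_le_degree hq).trans (h.degree_le_of_exhausts hG k)
  · rw [G.finrank_space, h.flag.finrank_space]

end IsDegreeBasis

/-! ### No nonzero elements of degree below m -/

theorem natDegree_one_add_X_le : (1 + X : ℝ[X]).natDegree ≤ 1 := by compute_degree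

theorem coeff_one_add_X_mul_derivative (q : ℝ[X]) :
    ((1 + X) * derivative q).coeff q.natDegree = q.natDegree * q.leadingCoeff := by
  rw [add_mul, one_mul, coeff_add, coeff_derivative,
    coeff_eq_zero_of_natDegree_lt (Nat.lt_succ_self _), leadingCoeff]
  rcases q.natDegree with _ | n
  · simp
  · rw [coeff_X_mul, coeff_derivative]
    push_cast
    ring

/-- A multiple of ξ of degree below m is zero, so (1 + x) q' + β q = 0. Its coefficient at d = deg q
is d + β times the leading coefficient of q, and d + β ≠ 0 because β ≠ 0 and β > -1. -/
theorem eq_zero_of_mem_xmSubspace {α β : ℝ} {m : ℕ} (hβ : -1 < β) (hβ0 : β ≠ 0)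
    (hξ : (xiPoly (α + 1) (β - 1) m).coeff m ≠ 0) {q : ℝ[X]} (hq : q ∈ xmSubspace α β m)
    (hdeg : q.natDegree < m) : q = 0 := by
  change jacobiPoly (-α - 1) (β - 1) m ∣ _ at hq
  rw [show -α - 1 = -(α + 1) by ring] at hq
  change xiPoly (α + 1) (β - 1) m ∣ _ at hq
  have h1 : ((1 + X) * derivative q + C β * q).natDegree < m := by
    refine lt_of_le_of_lt (natDegree_add_le_of_degree_le (n := q.natDegree) ?_
      (natDegree_C_mul_le _ _)) hdeg
    rcases Nat.eq_zero_or_pos q.natDegree with h | h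
    · rw [derivative_of_natDegree_zero h]
      simp
    · have := natDegree_mul_le_of_le natDegree_one_add_X_le (natDegree_derivative_le q)
      omega
  have h2 : (1 + X) * derivative q + C β * q = 0 := by
    by_contra hne
    have := natDegree_le_of_dvd hq hne
    exact absurd ((le_natDegree_of_ne_zero hξ).trans this) (not_le.2 h1)
  have h3 := congrArg (fun p => p.coeff q.natDegree) h2
  simp only [coeff_add, coeff_one_add_X_mul_derivative, coeff_C_mul, coeff_zero,
    coeff_natDegree, ← add_mul] at h3
  rcases mul_eq_zero.1 h3 with h | h
  · exfalso
    rcases Nat.eq_zero_or_pos q.natDegree with h0 | h0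
    · rw [h0, Nat.cast_zero, zero_add] at h
      exact hβ0 h
    · have : (1 : ℝ) ≤ q.natDegree := by exact_mod_cast h0
      linarith
  · exact leadingCoeff_eq_zero.1 h

/-! ### The exceptional differential equation -/

/-- The factors composed in the opposite order: `h2` expresses ξ P_k through y and y', and
substituting this and its derivative into the definition of y eliminates P_k. -/
theorem xmJacobi_ode (α β : ℝ) (m k : ℕ) :
    (1 - X ^ 2) * xiPoly (α + 1) (β - 1) m * derivative (derivative (xmJacobi α β m (m + k))) +
        (C (β + 1) * (1 - X) - C (α + 1) * (1 + X)) * xiPoly (α + 1) (β - 1) m *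
          derivative (xmJacobi α β m (m + k)) -
        2 * (1 - X ^ 2) * derivative (xiPoly (α + 1) (β - 1) m) *
          derivative (xmJacobi α β m (m + k)) -
        C β * (2 * (1 - X) * derivative (xiPoly (α + 1) (β - 1) m) +
          C (α + 1) * xiPoly (α + 1) (β - 1) m) * xmJacobi α β m (m + k) =
      C ((m - (α + 1) - k) * (m + β + k)) * xiPoly (α + 1) (β - 1) m *
        xmJacobi α β m (m + k) := by
  have h1 := one_sub_X_mul_derivative_xiPoly (α + 1) (β - 1) m
  have h2 := left_factor_xmJacobi α β m k
  have h3 := congrArg derivative h2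
  have h4 : xmJacobi α β m (m + k) = C ((-1) ^ (m + 1) / (α + 1 + k)) *
      ((1 - X) * xiPoly (α + 1) (β - 1) m * derivative (jacobiPoly (α + 1) (β - 1) k) +
        C ((m : ℝ) - (α + 1)) * xiPoly (α + 1 + 1) (β - 1 + 1) m *
          jacobiPoly (α + 1) (β - 1) k) := by
    unfold xmJacobi jacobiA
    rw [Nat.add_sub_cancel_left]
  simp only [derivative_mul, derivative_add, derivative_one, derivative_X, derivative_C,
    zero_mul, zero_add, one_mul] at h3
  rw [C_mul (a := (-1) ^ (m + 1) / (α + 1 + (k : ℝ)))] at h2 h3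
  generalize derivative (derivative (xmJacobi α β m (m + k))) = y2 at *
  generalize derivative (xmJacobi α β m (m + k)) = y1 at *
  generalize xmJacobi α β m (m + k) = y at *
  generalize derivative (jacobiPoly (α + 1) (β - 1) k) = p1 at *
  generalize jacobiPoly (α + 1) (β - 1) k = p at *
  generalize derivative (xiPoly (α + 1) (β - 1) m) = x1 at *
  generalize xiPoly (α + 1) (β - 1) m = x at *
  generalize xiPoly (α + 1 + 1) (β - 1 + 1) m = e at *
  generalize C ((-1) ^ (m + 1) / (α + 1 + (k : ℝ))) = c at *
  generalize C ((m - (α + 1) - k) * (m + β + k)) = κ at *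
  generalize C ((m : ℝ) - (α + 1)) = ν at *
  simp only [C_add, C_1] at *
  linear_combination (1 - X) * x * h3 - (2 * (1 - X) * x1 + (C α + 1) * x) * h2 -
    κ * x * h4 - c * κ * x * p * h1

/-- The Wronskian of two exceptional polynomials. -/
theorem xmJacobi_wronskian (α β : ℝ) (m i j : ℕ) (x : ℝ) :
    (1 - x ^ 2) * (xiPoly (α + 1) (β - 1) m).eval x *
        ((derivative (derivative (xmJacobi α β m (m + i)))).eval x *
            (xmJacobi α β m (m + j)).eval x -
          (xmJacobi α β m (m + i)).eval x *
            (derivative (derivative (xmJacobi α β m (m + j)))).eval x) +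
      (((β + 1) * (1 - x) - (α + 1) * (1 + x)) * (xiPoly (α + 1) (β - 1) m).eval x -
        2 * (1 - x ^ 2) * (derivative (xiPoly (α + 1) (β - 1) m)).eval x) *
        ((derivative (xmJacobi α β m (m + i))).eval x * (xmJacobi α β m (m + j)).eval x -
          (xmJacobi α β m (m + i)).eval x * (derivative (xmJacobi α β m (m + j))).eval x) =
      (((j : ℝ) - i) * (i + j + α + β + 1)) * (xiPoly (α + 1) (β - 1) m).eval x *
        ((xmJacobi α β m (m + i)).eval x * (xmJacobi α β m (m + j)).eval x) := by
  have hi := congrArg (eval x) (xmJacobi_ode α β m i)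
  have hj := congrArg (eval x) (xmJacobi_ode α β m j)
  simp only [eval_mul, eval_add, eval_sub, eval_C, eval_X, eval_one, eval_pow, eval_ofNat] at hi hj
  linear_combination (xmJacobi α β m (m + j)).eval x * hi - (xmJacobi α β m (m + i)).eval x * hj

/-! ### Weighted integrals -/

theorem intervalIntegrable_jacobiWeight {α β : ℝ} (hα : -1 < α) (hβ : -1 < β) :
    IntervalIntegrable (fun x : ℝ => (1 - x) ^ α * (1 + x) ^ β) volume (-1) 1 := by
  have h1 : IntervalIntegrable (fun x : ℝ => (1 + x) ^ β) volume (-1) 0 := by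
    have := (intervalIntegral.intervalIntegrable_rpow' (a := 0) (b := 1) hβ).comp_add_left 1
    norm_num at this
    exact this
  have h2 : IntervalIntegrable (fun x : ℝ => (1 - x) ^ α) volume 0 1 := by
    have := (intervalIntegral.intervalIntegrable_rpow' (a := 1) (b := 0) hα).comp_sub_left 1
    norm_num at this
    exact this
  -- On each half of the interval only one of the two factors can be singular.
  refine IntervalIntegrable.trans (b := 0) ?_ ?_
  · refine h1.continuousOn_mul ?_
    rw [Set.uIcc_of_le (by norm_num)]
    intro x hx
    refine ContinuousAt.continuousWithinAt (ContinuousAt.rpow_const (by fun_prop) (Or.inl ?_))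
    have := hx.2
    linarith
  · refine h2.mul_continuousOn ?_
    rw [Set.uIcc_of_le (by norm_num)]
    intro x hx
    refine ContinuousAt.continuousWithinAt (ContinuousAt.rpow_const (by fun_prop) (Or.inl ?_))
    have := hx.1
    linarith

section Weight

variable {W : ℝ → ℝ}

theorem integral_weightMeasure (hW : Measurable W) (hpos : ∀ x ∈ Set.Ioo (-1 : ℝ) 1, 0 < W x)
    (f : ℝ → ℝ) :
    ∫ x, f x ∂(weightMeasure (-1) 1 W) = ∫ x in (-1)..1, W x * f x := by
  unfold weightMeasure
  rw [integral_withDensity_eq_integral_toReal_smul hW.ennreal_ofReal (by simp),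
    intervalIntegral.integral_of_le (by norm_num), integral_Ioc_eq_integral_Ioo]
  refine setIntegral_congr_fun measurableSet_Ioo fun x hx => ?_
  simp [ENNReal.toReal_ofReal (hpos x hx).le]

theorem integrable_weightMeasure (hW : Measurable W) (hpos : ∀ x ∈ Set.Ioo (-1 : ℝ) 1, 0 < W x)
    {f : ℝ → ℝ} (hf : IntervalIntegrable (fun x => W x * f x) volume (-1) 1) :
    Integrable f (weightMeasure (-1) 1 W) := by
  unfold weightMeasure
  rw [integrable_withDensity_iff_integrable_smul' hW.ennreal_ofReal (by simp)]
  rw [intervalIntegrable_iff_integrableOn_Ioo_of_le (by norm_num)] at hf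
  refine (integrableOn_congr_fun (fun x hx => ?_) measurableSet_Ioo).1 hf
  simp [ENNReal.toReal_ofReal (hpos x hx).le]

theorem ae_weightMeasure_mem (W : ℝ → ℝ) :
    ∀ᵐ x ∂(weightMeasure (-1) 1 W), x ∈ Set.Ioo (-1 : ℝ) 1 :=
  (withDensity_absolutelyContinuous _ _).ae_le (ae_restrict_mem measurableSet_Ioo)

/-- Otherwise q would vanish almost everywhere on (-1, 1), which would then be covered by finitely
many roots and a null set. -/
theorem integral_mul_self_weightMeasure_ne_zero (hW : Measurable W)
    (hpos : ∀ x ∈ Set.Ioo (-1 : ℝ) 1, 0 < W x) {q : ℝ[X]} (hq : q ≠ 0)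
    (hint : Integrable (fun x => q.eval x * q.eval x) (weightMeasure (-1) 1 W)) :
    ∫ x, q.eval x * q.eval x ∂(weightMeasure (-1) 1 W) ≠ 0 := by
  intro h
  rw [integral_eq_zero_iff_of_nonneg (fun x => mul_self_nonneg _) hint] at h
  unfold weightMeasure at h
  rw [Filter.EventuallyEq, ae_withDensity_iff hW.ennreal_ofReal,
    ae_restrict_iff' measurableSet_Ioo] at h
  have hsub : Set.Ioo (-1 : ℝ) 1 ⊆ {x | q.IsRoot x} ∪ {x | ¬ (x ∈ Set.Ioo (-1 : ℝ) 1 →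
      ENNReal.ofReal (W x) ≠ 0 → q.eval x * q.eval x = (0 : ℝ → ℝ) x)} := by
    intro x hx
    by_cases hr : q.IsRoot x
    · exact Or.inl hr
    · refine Or.inr fun hcon => hr ?_
      have := hcon hx (by simpa using hpos x hx)
      exact mul_self_eq_zero.1 this
  have h_null := measure_mono_null hsub (measure_union_null
    ((finite_setOfPred_isRoot hq).measure_zero volume) (ae_iff.1 h))
  simp at h_null
  norm_num at h_null

end Weight

/-- Bounded continuous functions are dense in L² of a finite measure, and by Weierstrass they are
uniformly approximable on [a, b]. A uniform error δ costs at most δ μ(ℝ)^(1/2) in L². -/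
theorem exists_polynomial_eLpNorm_sub_le {a b : ℝ} (μ : Measure ℝ) [IsFiniteMeasure μ]
    (hμ : ∀ᵐ x ∂μ, x ∈ Set.Icc a b) {f : ℝ → ℝ} (hf : MemLp f 2 μ) {ε : ℝ≥0∞} (hε : ε ≠ 0) :
    ∃ q : ℝ[X], eLpNorm (fun x => f x - q.eval x) 2 μ ≤ ε := by
  have hε2 : ε / 2 ≠ 0 := by simpa using hε
  obtain ⟨g, hg, hgm⟩ := hf.exists_boundedContinuous_eLpNorm_sub_le (by simp) hε2
  obtain ⟨δ, hδ, hδε⟩ := ENNReal.exists_nnreal_pos_mul_lt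
    (a := μ Set.univ ^ (2 : ℝ≥0∞).toReal⁻¹) (by simp [measure_ne_top]) hε2
  obtain ⟨q, hq⟩ := exists_polynomial_near_of_continuousOn a b g g.continuous.continuousOn δ hδ
  refine ⟨q, ?_⟩
  have e : (fun x => f x - q.eval x) = (f - g) + fun x => g x - q.eval x := by
    ext x; simp
  have hqm : AEStronglyMeasurable (fun x => g x - q.eval x) μ :=
    (g.continuous.sub q.continuous).aestronglyMeasurable
  rw [e, ← ENNReal.add_halves ε]
  refine (eLpNorm_add_le (hf.1.sub hgm.1) hqm (by norm_num)).trans (add_le_add hg ?_)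
  refine (eLpNorm_le_of_ae_bound (C := (δ : ℝ)) ?_).trans ?_
  · filter_upwards [hμ] with x hx
    rw [Real.norm_eq_abs, abs_sub_comm]
    exact (hq x hx).le
  · rw [mul_comm, ENNReal.ofReal_coe_nnreal]
    exact hδε.le

/-! ### The exceptional weight: orthogonality and density -/

section XmWeight

variable {α β : ℝ} {m : ℕ}

theorem measurable_xmWeight : Measurable (xmWeight α β m) := by
  unfold xmWeight
  refine Measurable.div (by fun_prop) ?_
  exact ((xiPoly (α + 1) (β - 1) m).continuous.measurable).pow_const 2

theorem xmWeight_pos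
    (hξ : ∀ x ∈ Set.Icc (-1 : ℝ) 1, (xiPoly (α + 1) (β - 1) m).eval x ≠ 0) {x : ℝ}
    (hx : x ∈ Set.Ioo (-1 : ℝ) 1) : 0 < xmWeight α β m x := by
  have h1 : 0 < 1 - x := by linarith [hx.2]
  have h2 : 0 < 1 + x := by linarith [hx.1]
  have h3 := hξ x (Set.Ioo_subset_Icc_self hx)
  unfold xmWeight
  positivity

theorem intervalIntegrable_xmWeight_mul (hα : -1 < α) (hβ : -1 < β)
    (hξ : ∀ x ∈ Set.Icc (-1 : ℝ) 1, (xiPoly (α + 1) (β - 1) m).eval x ≠ 0) {f : ℝ → ℝ}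
    (hf : Continuous f) :
    IntervalIntegrable (fun x => xmWeight α β m x * f x) volume (-1) 1 := by
  have : (fun x => xmWeight α β m x * f x) = fun x : ℝ => ((1 - x) ^ α * (1 + x) ^ β) *
      (f x / (xiPoly (α + 1) (β - 1) m).eval x ^ 2) := by
    ext x
    unfold xmWeight
    ring
  rw [this]
  refine (intervalIntegrable_jacobiWeight hα hβ).mul_continuousOn ?_
  rw [Set.uIcc_of_le (by norm_num)]
  exact hf.continuousOn.div
    ((xiPoly (α + 1) (β - 1) m).continuous.pow 2).continuousOn fun x hx => pow_ne_zero 2 (hξ x hx)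

theorem integrable_xmWeight (hα : -1 < α) (hβ : -1 < β)
    (hξ : ∀ x ∈ Set.Icc (-1 : ℝ) 1, (xiPoly (α + 1) (β - 1) m).eval x ≠ 0) {f : ℝ → ℝ}
    (hf : Continuous f) : Integrable f (weightMeasure (-1) 1 (xmWeight α β m)) :=
  integrable_weightMeasure measurable_xmWeight (fun _ hx => xmWeight_pos hξ hx)
    (intervalIntegrable_xmWeight_mul hα hβ hξ hf)

/-- The factor p = (1 - x)^(α+1) (1 + x)^(β+1) / ξ² is the Sturm–Liouville integrating factor of the
exceptional equation: p'/p is its first-order coefficient divided by its leading one. The constant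
is the difference of the eigenvalues. -/
theorem hasDerivAt_weighted_wronskian
    (hξ : ∀ x ∈ Set.Icc (-1 : ℝ) 1, (xiPoly (α + 1) (β - 1) m).eval x ≠ 0) (i j : ℕ) {x : ℝ}
    (hx : x ∈ Set.Ioo (-1 : ℝ) 1) :
    HasDerivAt (fun x : ℝ => ((1 - x) ^ (α + 1) * (1 + x) ^ (β + 1)) *
      (((derivative (xmJacobi α β m (m + i))).eval x * (xmJacobi α β m (m + j)).eval x -
          (xmJacobi α β m (m + i)).eval x * (derivative (xmJacobi α β m (m + j))).eval x) /
        (xiPoly (α + 1) (β - 1) m).eval x ^ 2))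
      ((((j : ℝ) - i) * (i + j + α + β + 1)) * (xmWeight α β m x *
        ((xmJacobi α β m (m + i)).eval x * (xmJacobi α β m (m + j)).eval x))) x := by
  have h1 : 0 < 1 - x := by linarith [hx.2]
  have h2 : 0 < 1 + x := by linarith [hx.1]
  have h3 := hξ x (Set.Ioo_subset_Icc_self hx)
  have d1 := ((hasDerivAt_id x).const_sub 1).rpow_const (p := α + 1) (Or.inl h1.ne')
  have d2 := ((hasDerivAt_id x).const_add 1).rpow_const (p := β + 1) (Or.inl h2.ne')
  have d3 := ((xiPoly (α + 1) (β - 1) m).hasDerivAt x).pow 2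
  have yi := (xmJacobi α β m (m + i)).hasDerivAt x
  have yj := (xmJacobi α β m (m + j)).hasDerivAt x
  have yi' := (derivative (xmJacobi α β m (m + i))).hasDerivAt x
  have yj' := (derivative (xmJacobi α β m (m + j))).hasDerivAt x
  refine ((d1.mul d2).mul (((yi'.mul yj).sub (yi.mul yj')).div d3 (pow_ne_zero 2 h3))).congr_deriv ?_
  have hw := xmJacobi_wronskian α β m i j x
  unfold xmWeight
  simp only [Pi.mul_apply, Pi.sub_apply, Pi.pow_apply, Pi.div_apply, id_eq, add_sub_cancel_right]
  rw [Real.rpow_add_one h1.ne', Real.rpow_add_one h2.ne']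
  generalize (1 - x) ^ α = u
  generalize (1 + x) ^ β = v
  generalize eval x (xiPoly (α + 1) (β - 1) m) = ξ at *
  field_simp
  push_cast
  linear_combination u * v * ξ * hw

theorem integral_xmJacobi_mul_xmJacobi (hm : 1 < m) (hα : -1 < α) (hβ : -1 < β)
    (hαm : (m : ℝ) - 2 < α)
    (hξ : ∀ x ∈ Set.Icc (-1 : ℝ) 1, (xiPoly (α + 1) (β - 1) m).eval x ≠ 0) {i j : ℕ}
    (hij : i ≠ j) :
    ∫ x, (xmJacobi α β m (m + i)).eval x * (xmJacobi α β m (m + j)).eval x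
      ∂(weightMeasure (-1) 1 (xmWeight α β m)) = 0 := by
  rw [integral_weightMeasure measurable_xmWeight (fun _ hx => xmWeight_pos hξ hx)]
  have hint := intervalIntegrable_xmWeight_mul (m := m) hα hβ hξ
    ((xmJacobi α β m (m + i)).continuous.mul (xmJacobi α β m (m + j)).continuous)
  have hm2 : (2 : ℝ) ≤ m := by exact_mod_cast hm
  -- Eigenvalues are distinct: α > m - 2 ≥ 0 and β > -1 make the second factor positive.
  have hc : (((j : ℝ) - i) * (i + j + α + β + 1)) ≠ 0 := by
    refine mul_ne_zero (sub_ne_zero.2 (by exact_mod_cast hij.symm)) ?_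
    have : (0 : ℝ) ≤ i := i.cast_nonneg
    have : (0 : ℝ) ≤ j := j.cast_nonneg
    linarith
  have hftc := intervalIntegral.integral_eq_sub_of_hasDerivAt_of_le (a := -1) (b := 1)
    (by norm_num) ?_ (fun x hx => hasDerivAt_weighted_wronskian hξ i j hx) (hint.const_mul _)
  · rw [intervalIntegral.integral_const_mul] at hftc
    refine (mul_eq_zero.1 (hftc.trans ?_)).resolve_left hc
    -- The boundary terms vanish because both exponents α + 1 and β + 1 are positive.
    have e1 : (0 : ℝ) ^ (α + 1) = 0 := Real.zero_rpow (by linarith)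
    have e2 : (0 : ℝ) ^ (β + 1) = 0 := Real.zero_rpow (by linarith)
    norm_num [e1, e2]
  · refine ContinuousOn.mul (Continuous.continuousOn ?_) (ContinuousOn.div
      (Continuous.continuousOn ?_) (Continuous.continuousOn ?_)
      fun x hx => pow_ne_zero 2 (hξ x hx))
    · exact ((continuous_const.sub continuous_id).rpow_const fun x => Or.inr (by linarith)).mul
        ((continuous_const.add continuous_id).rpow_const fun x => Or.inr (by linarith))
    · fun_prop
    · fun_prop

/-- The derivative of ξ² q still contains a factor ξ. These multiples alone already suffice for
density. -/
theorem sq_xiPoly_mul_mem_xmSubspace (q : ℝ[X]) :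
    xiPoly (α + 1) (β - 1) m ^ 2 * q ∈ xmSubspace α β m := by
  change jacobiPoly (-α - 1) (β - 1) m ∣ _
  rw [show -α - 1 = -(α + 1) by ring]
  change xiPoly (α + 1) (β - 1) m ∣ _
  generalize xiPoly (α + 1) (β - 1) m = ξ
  rw [derivative_mul, derivative_pow]
  refine ⟨(1 + X) * (2 * derivative ξ * q + ξ * derivative q) + C β * ξ * q, ?_⟩
  simp only [Nat.cast_ofNat, map_ofNat]
  ring

theorem exists_mem_xmSubspace_eLpNorm_sub_lt (hα : -1 < α) (hβ : -1 < β)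
    (hξ : ∀ x ∈ Set.Icc (-1 : ℝ) 1, (xiPoly (α + 1) (β - 1) m).eval x ≠ 0) {f : ℝ → ℝ}
    (hf : MemLp f 2 (weightMeasure (-1) 1 (xmWeight α β m))) {ε : ℝ≥0∞} (hε : 0 < ε) :
    ∃ q ∈ xmSubspace α β m,
      eLpNorm (fun x => f x - q.eval x) 2 (weightMeasure (-1) 1 (xmWeight α β m)) < ε := by
  have hfin : IsFiniteMeasure (weightMeasure (-1) 1 (xmWeight α β m)) := by
    have := integrable_xmWeight (m := m) hα hβ hξ (continuous_const (y := (1 : ℝ)))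
    rwa [integrable_const_iff_isFiniteMeasure one_ne_zero] at this
  have hmem := ae_weightMeasure_mem (xmWeight α β m)
  generalize weightMeasure (-1) 1 (xmWeight α β m) = μ at *
  set ξ := xiPoly (α + 1) (β - 1) m with hξdef
  have hcont : Continuous fun x => ξ.eval x ^ 2 := ξ.continuous.pow 2
  have hicont : ContinuousOn (fun x => (ξ.eval x ^ 2)⁻¹) (Set.Icc (-1) 1) :=
    hcont.continuousOn.inv₀ fun x hx => pow_ne_zero 2 (hξ x hx)
  obtain ⟨M, hM⟩ := isCompact_Icc.exists_bound_of_continuousOn (hcont.continuousOn (s := Set.Icc (-1) 1))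
  obtain ⟨N, hN⟩ := isCompact_Icc.exists_bound_of_continuousOn hicont
  -- The quotient f / ξ² is approximated by a polynomial q, and ξ² q then approximates f, with the
  -- error multiplied by at most M, a bound for ξ² on [-1, 1].
  have hh : MemLp (fun x => (ξ.eval x ^ 2)⁻¹ * f x) 2 μ := by
    refine hf.of_le_mul (c := N) (hcont.measurable.inv.aestronglyMeasurable.mul hf.1) ?_
    filter_upwards [hmem] with x hx
    rw [norm_mul]
    exact mul_le_mul_of_nonneg_right (hN x (Set.Ioo_subset_Icc_self hx)) (norm_nonneg _)
  obtain ⟨δ, hδ, hδε⟩ := ENNReal.exists_nnreal_pos_mul_lt (a := ENNReal.ofReal M) (by simp) hε.ne'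
  obtain ⟨q, hq⟩ := exists_polynomial_eLpNorm_sub_le μ
    (hmem.mono fun x hx => Set.Ioo_subset_Icc_self hx) hh (ε := δ) (by simpa using hδ.ne')
  refine ⟨ξ ^ 2 * q, sq_xiPoly_mul_mem_xmSubspace q, ?_⟩
  have hle : ∀ᵐ x ∂μ, ‖f x - (ξ ^ 2 * q).eval x‖ ≤ M * ‖(ξ.eval x ^ 2)⁻¹ * f x - q.eval x‖ := by
    filter_upwards [hmem] with x hx
    have hx' := Set.Ioo_subset_Icc_self hx
    have h0 : ξ.eval x ^ 2 ≠ 0 := pow_ne_zero 2 (hξ x hx')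
    have : f x - (ξ ^ 2 * q).eval x = ξ.eval x ^ 2 * ((ξ.eval x ^ 2)⁻¹ * f x - q.eval x) := by
      rw [eval_mul, eval_pow, mul_sub, mul_inv_cancel_left₀ h0]
    rw [this, norm_mul]
    exact mul_le_mul_of_nonneg_right (hM x hx') (norm_nonneg _)
  refine (eLpNorm_le_mul_eLpNorm_of_ae_le_mul hle 2).trans_lt (lt_of_le_of_lt ?_ hδε)
  rw [mul_comm]
  gcongr

end XmWeight

/-! ### The main theorem -/

/-- Two orthogonalizations of a flag differ by nonzero factors only. -/
theorem exists_smul_eq_of_isOrthogonalization {F : PolynomialFlag} {μ : Measure ℝ} {y z : ℕ → ℝ[X]}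
    (hint : ∀ q : ℝ[X], Integrable (fun x => q.eval x) μ)
    (hpos : ∀ q : ℝ[X], q ≠ 0 → ∫ x, q.eval x * q.eval x ∂μ ≠ 0)
    (hy : F.IsOrthogonalization μ y) (hz : F.IsOrthogonalization μ z) (k : ℕ) :
    ∃ c : ℝ, z k = c • y k := by
  have hlin : ∀ (p q r : ℝ[X]) (c : ℝ), ∫ x, (p + c • q).eval x * r.eval x ∂μ =
      ∫ x, p.eval x * r.eval x ∂μ + c * ∫ x, q.eval x * r.eval x ∂μ := by
    intro p q r c
    rw [← integral_const_mul, ← integral_add]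
    · refine integral_congr_ae (Filter.Eventually.of_forall fun x => ?_)
      simp only [eval_add, eval_smul, smul_eq_mul]
      ring
    · simpa only [eval_mul] using hint (p * r)
    · simpa only [eval_mul] using (hint (q * r)).const_mul c
  -- The span of y_0, …, y_{k-1} is the preceding space of the flag, or 0 when k = 0. It does not
  -- depend on the orthogonalization chosen, so both `y k` and `z k` are orthogonal to it.
  have hperp : ∀ w : ℕ → ℝ[X], F.IsOrthogonalization μ w → ∀ q ∈ Submodule.span ℝ (y '' Set.Iio k),
      ∫ x, q.eval x * (w k).eval x ∂μ = 0 := by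
    intro w hw q hq
    rcases k with _ | k
    · have : q = 0 := by simpa using hq
      simp [this]
    rw [Set.Iio_add_one_eq_Iic, ← hy.1 k, hw.1 k] at hq
    induction hq using Submodule.span_induction with
    | mem q hq =>
      obtain ⟨i, hi, rfl⟩ := hq
      exact hw.2 i (k + 1) (Nat.ne_of_lt (Nat.lt_succ_of_le hi))
    | zero => simp
    | add p q _ _ hp hq =>
      have := hlin p q (w (k + 1)) 1
      rw [one_smul] at this
      rw [this, hp, hq]
      simp
    | smul c q _ hq =>
      have := hlin 0 q (w (k + 1)) c
      rw [zero_add] at this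
      rw [this, hq]
      simp
  have hzk : z k ∈ Submodule.span ℝ (y '' Set.Iic k) := by
    rw [← hy.1 k, hz.1 k]
    exact Submodule.subset_span (Set.mem_image_of_mem z Set.self_mem_Iic)
  rw [← Set.Iio_insert, Set.image_insert_eq, Submodule.mem_span_insert] at hzk
  obtain ⟨c, q, hq, hzq⟩ := hzk
  refine ⟨c, ?_⟩
  have hq' : q = z k + (-c) • y k := by
    rw [hzq, neg_smul]; abel
  -- The difference q = z_k - c y_k lies in the preceding space and is orthogonal to it, hence to
  -- itself.
  have h0 : ∫ x, q.eval x * q.eval x ∂μ = 0 := by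
    have h1 := hlin (z k) (y k) q (-c)
    rw [← hq'] at h1
    rw [h1]
    simp only [mul_comm _ (eval _ q)]
    rw [hperp z hz q hq, hperp y hy q hq, mul_zero, add_zero]
  have : q = 0 := by
    by_contra hne
    exact hpos q hne h0
  rw [hzq, this, add_zero]

theorem normalization_ne_zero {α : ℝ} {m : ℕ} (hα : -1 < α) (hαi : ∀ i : ℕ, i < m → α ≠ (i : ℝ))
    (k : ℕ) :
    Ring.choose (α + ((m + k : ℕ) : ℝ) - m) (m + k) * ((m + k).choose m : ℝ) ≠ 0 := by
  refine mul_ne_zero (choose_ne_zero fun i hi he => ?_) ?_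
  · push_cast at he
    -- A zero factor means α = i - k with i < m + k: this is at most -1 if i < k, and otherwise one
    -- of the excluded values 0, …, m - 1.
    rcases lt_or_ge i k with h | h
    · have : (i : ℝ) + 1 ≤ k := by exact_mod_cast h
      linarith
    · refine hαi (i - k) (by omega) ?_
      rw [Nat.cast_sub h]
      linarith
  · exact_mod_cast (Nat.choose_pos (Nat.le_add_right m k)).ne'

theorem isDegreeBasis_xmJacobi {α β : ℝ} {m : ℕ} (hm : 1 < m) (hβ : -1 < β) (hβ0 : β ≠ 0)
    (hαm : (m : ℝ) - 2 < α)
    (hnonsing : ∀ i : ℕ, i < m → α ≠ (i : ℝ) ∧ α - β - (m : ℝ) + 1 ≠ (i : ℝ)) :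
    IsDegreeBasis (xmSubspace α β m) m fun k => xmJacobi α β m (m + k) where
  mem := xmJacobi_mem_xmSubspace α β m
  natDegree_le := natDegree_xmJacobi_le α β m
  coeff_ne_zero := coeff_xmJacobi_ne_zero hm hβ hαm hnonsing
  eq_zero _ hq hd := eq_zero_of_mem_xmSubspace hβ hβ0
    (coeff_xiPoly_ne_zero fun i hi => (hnonsing i hi).2) hq hd

theorem mainTheorem3 (m : ℕ) (hm : 1 < m) (α β : ℝ) (hα : -1 < α) (hβ : -1 < β)
    (hαm : (m : ℝ) - 2 < α)
    (hsign : SignType.sign (α - (m : ℝ) + 1) = SignType.sign β)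
    (hnonsing : ∀ i : ℕ, i < m → α ≠ (i : ℝ) ∧ α - β - (m : ℝ) + 1 ≠ (i : ℝ)) :
    ∃ F : PolynomialFlag,
      (∀ G : PolynomialFlag, G.Exhausts (xmSubspace α β m) ↔ G = F) ∧
      F.HasStableCodim m ∧
      IsOrthogonalPolynomialSystem (-1) 1 (xmWeight α β m) (fun k => xmJacobi α β m (m + k)) ∧
      ∀ y : ℕ → ℝ[X],
        (F.IsOrthogonalization (weightMeasure (-1) 1 (xmWeight α β m)) y ∧
          ∀ n : ℕ, m ≤ n →
            (y (n - m)).eval 1 =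
              Ring.choose (α + (n : ℝ) - (m : ℝ)) n * (n.choose m : ℝ)) ↔
        y = fun k => xmJacobi α β m (m + k) := by
  have hαm1 : α ≠ (m : ℝ) - 1 := by
    have := (hnonsing (m - 1) (by omega)).1
    rwa [Nat.cast_sub hm.le, Nat.cast_one] at this
  -- The sign condition would turn β = 0 into α = m - 1, which is excluded.
  have hβ0 : β ≠ 0 := by
    rintro rfl
    rw [sign_zero, sign_eq_zero_iff] at hsign
    exact hαm1 (by linarith)
  have hξ : ∀ x ∈ Set.Icc (-1 : ℝ) 1, (xiPoly (α + 1) (β - 1) m).eval x ≠ 0 := fun x hx =>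
    xiPoly_eval_ne_zero (by omega) hβ hαm hsign hαm1 hx
  have hB := isDegreeBasis_xmJacobi hm hβ hβ0 hαm hnonsing
  have horth : ∀ i j, i ≠ j → ∫ x, (xmJacobi α β m (m + i)).eval x *
      (xmJacobi α β m (m + j)).eval x ∂(weightMeasure (-1) 1 (xmWeight α β m)) = 0 :=
    fun i j hij => integral_xmJacobi_mul_xmJacobi hm hα hβ hαm hξ hij
  have hint : ∀ q : ℝ[X],
      Integrable (fun x => q.eval x) (weightMeasure (-1) 1 (xmWeight α β m)) :=
    fun q => integrable_xmWeight hα hβ hξ q.continuous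
  have hpos : ∀ q : ℝ[X], q ≠ 0 →
      ∫ x, q.eval x * q.eval x ∂(weightMeasure (-1) 1 (xmWeight α β m)) ≠ 0 := fun q hq =>
    integral_mul_self_weightMeasure_ne_zero measurable_xmWeight
      (fun _ hx => xmWeight_pos hξ hx) hq (by simpa only [eval_mul] using hint (q * q))
  have hF : hB.flag.IsOrthogonalization (weightMeasure (-1) 1 (xmWeight α β m))
      fun k => xmJacobi α β m (m + k) := ⟨fun _ => rfl, horth⟩
  refine ⟨hB.flag, hB.exhausts_iff, hB.hasStableCodim_flag, ?_, fun y => ⟨?_, ?_⟩⟩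
  · refine ⟨fun x hx => xmWeight_pos hξ hx, fun n => ?_, hB.ne_zero, horth, fun f hf ε hε => ?_⟩
    · exact integrable_xmWeight hα hβ hξ (continuous_pow n)
    · rw [hB.span_range]
      exact exists_mem_xmSubspace_eLpNorm_sub_lt hα hβ hξ hf hε
  · rintro ⟨hy, hy1⟩
    funext k
    obtain ⟨c, hc⟩ := exists_smul_eq_of_isOrthogonalization hint hpos hF hy k
    have h1 := hy1 (m + k) (Nat.le_add_right m k)
    rw [Nat.add_sub_cancel_left, hc, eval_smul, xmJacobi_eval_one hα β (Nat.le_add_right m k),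
      smul_eq_mul] at h1
    have hc1 : c = 1 :=
      mul_right_cancel₀ (normalization_ne_zero hα (fun i hi => (hnonsing i hi).1) k)
        (h1.trans (one_mul _).symm)
    rw [hc, hc1, one_smul]
  · rintro rfl
    refine ⟨hF, fun n hn => ?_⟩
    simp only [Nat.add_sub_cancel' hn]
    exact xmJacobi_eval_one hα β hn
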